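/- For $\theta\in\mathbb R$ let $\mathbb C_\theta=\{s\in\mathbb C:\operatorname{Re}s>\theta\}$ and $\mathbb C_+=\mathbb C_0$. Let $\mathcal H$ be the Hilbert space of Dirichlet series $f(s)=\sum_{n\ge1}a_nn^{-s}$ with $\|f\|^2=\sum_{n\ge 1}|a_n|^2<\infty$; its elements are analytic functions on $\mathbb C_{1/2}$. Let $\mathcal C(\mathcal H)$ be the set of bounded composition operators $C_\varphi:f\mapsto f\circ\varphi$ on $\mathcal H$, where $\varphi$ is an analytic self-map of $\mathbb C_{1/2}$, endowed with the operator norm topology. The Gordon--Hedenmalm class $\mathcal G$ consists of the maps $\varphi:\mathbb C_{1/2}\to\mathbb C_{1/2}$ of the form $\varphi(s)=c_0s+\psi(s)$, where $c_0$ is a non-negative integer (the characteristic of $\varphi$) and $\psi(s)=\sum_{n\ge1}c_nn^{-s}$ converges uniformly in $\mathbb C_\varepsilon$ for every $\varepsilon>0$ (so that $\varphi$ and $\psi$ are defined on $\mathbb C_+$), such that: if $c_0=0$, then $\psi(\mathbb C_+)\subseteq\mathbb C_{1/2}$; if $c_0\ge1$, then either $\psi$ is a constant $c_1$ with $\operatorname{Re}c_1\ge0$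 or $\psi(\mathbb C_+)\subseteq\mathbb C_+$. **Theorem.** Let $\varphi_0,\varphi_1\in\mathcal G$ have the same characteristic $c_0\ge1$, and write $\varphi_0(s)=c_0s+\psi_0(s)$, $\varphi_1(s)=c_0s+\psi_1(s)$. Assume that there exists $C>0$ such that on $\mathbb C_+$ $$|\varphi_0-\varphi_1|\le C\min(\operatorname{Re}\varphi_0,\operatorname{Re}\varphi_1),\qquad |\psi_0|\le C,\quad |\psi_1|\le C,\qquad |\varphi_0'-\varphi_1'|\le C.$$ Then $C_{\varphi_0}$ and $C_{\varphi_1}$ are bounded operators on $\mathcal H$ and belong to the same connected component of $\mathcal C(\mathcal H)$. If moreover, for $s\in\mathbb C_+$, $$|\varphi_0-\varphi_1|=o\big(\min(\operatorname{Re}\varphi_0,\operatorname{Re}\varphi_1)\big)\quad\text{and}\quad\varphi_0'-\varphi_1'\to0\qquad\text{as }\min(\operatorname{Re}\varphi_0,\operatorname{Re}\varphi_1)\to0,$$ then $C_{\varphi_0}-C_{\varphi_1}$ is a compact operator on $\mathcal H$. -/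

import Mathlib

open Filter Topology Asymptotics

/-- The open half-plane of complex numbers with real part larger than `θ`. -/
def halfPlane (θ : ℝ) : Set ℂ := {s : ℂ | θ < s.re}

/-- The Hardy space of Dirichlet series with square summable coefficients: the series
`∑ a n * n ^ (-s)` (`n ≥ 1`) is represented by its coefficient sequence `a`, and its norm is the
`ℓ²` norm of `a`. -/
abbrev HardyDirichlet : Type := lp (fun _ : ℕ+ => ℂ) 2

namespace HardyDirichlet

/-- The value at `s` of a Dirichlet series with square summable coefficients
(the series converges absolutely if `1 / 2 < s.re`). -/
noncomputable def eval (f : HardyDirichlet) (s : ℂ) : ℂ :=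
  ∑' n : ℕ+, f n * ((n : ℕ) : ℂ) ^ (-s)

end HardyDirichlet

/-- `T` is the composition operator `C_φ : f ↦ f ∘ φ` on the Hardy space of Dirichlet series. -/
def IsCompositionOperator (φ : ℂ → ℂ) (T : HardyDirichlet →L[ℂ] HardyDirichlet) : Prop :=
  ∀ f : HardyDirichlet, ∀ s ∈ halfPlane (1 / 2), (T f).eval s = f.eval (φ s)

/-- The set of all (bounded) composition operators on the Hardy space of Dirichlet series, that is,
of those induced by analytic self-maps of the half-plane `1 / 2 < s.re`, as a subset of the space
of bounded operators with its operator norm. -/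
def compositionOperators : Set (HardyDirichlet →L[ℂ] HardyDirichlet) :=
  {T | ∃ φ : ℂ → ℂ, DifferentiableOn ℂ φ (halfPlane (1 / 2)) ∧
    Set.MapsTo φ (halfPlane (1 / 2)) (halfPlane (1 / 2)) ∧ IsCompositionOperator φ T}

/-- `φ` belongs to the Gordon-Hedenmalm class, with characteristic `c₀` and with
`φ s = c₀ * s + ψ s`. Only the values of `φ` and `ψ` on `0 < s.re` matter. -/
structure IsGordonHedenmalm (φ : ℂ → ℂ) (c₀ : ℕ) (ψ : ℂ → ℂ) : Prop where
  mapsTo : Set.MapsTo φ (halfPlane (1 / 2)) (halfPlane (1 / 2))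
  eq_add : ∀ s ∈ halfPlane 0, φ s = c₀ * s + ψ s
  series : ∃ c : ℕ → ℂ, ∀ ε : ℝ, 0 < ε →
    TendstoUniformlyOn (fun (N : ℕ) (s : ℂ) => ∑ n ∈ Finset.Icc 1 N, c n * (n : ℂ) ^ (-s)) ψ atTop
      (halfPlane ε)
  char_zero : c₀ = 0 → Set.MapsTo ψ (halfPlane 0) (halfPlane (1 / 2))
  char_pos : 1 ≤ c₀ →
    (∃ c₁ : ℂ, 0 ≤ c₁.re ∧ ∀ s ∈ halfPlane 0, ψ s = c₁) ∨
      Set.MapsTo ψ (halfPlane 0) (halfPlane 0)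

/-- The filter on the half-plane `0 < s.re` along which `min (Re φ₀ s) (Re φ₁ s)` tends to `0`. -/
def minReToZero (φ₀ φ₁ : ℂ → ℂ) : Filter ℂ :=
  𝓟 (halfPlane 0) ⊓ comap (fun s : ℂ => min (φ₀ s).re (φ₁ s).re) (𝓝 0)

namespace HardyDirichlet

theorem eval_eq_LSeries (f : HardyDirichlet) (s : ℂ) :
    f.eval s = LSeries (fun n => if h : 0 < n then f ⟨n, h⟩ else 0) s := by
  have h1 : ∀ n : ℕ+, f n * ((n : ℕ) : ℂ) ^ (-s) =
      LSeries.term (fun n => if h : 0 < n then f ⟨n, h⟩ else 0) s (n : ℕ) := by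
    intro n
    rw [LSeries.term_of_ne_zero n.pos.ne', dif_pos n.pos, Complex.cpow_neg, div_eq_mul_inv]
    rfl
  unfold eval LSeries
  rw [tsum_congr h1]
  refine tsum_subtype_eq_of_support_subset (s := {n : ℕ | 0 < n})
    (f := LSeries.term (fun n => if h : 0 < n then f ⟨n, h⟩ else 0) s) ?_
  intro n hn
  rcases Nat.eq_zero_or_pos n with rfl | h
  · simp at hn
  · exact h

/-- A square summable Dirichlet series is determined by its values on `1 / 2 < s.re`. -/
theorem eq_of_eval_eq {f g : HardyDirichlet}
    (h : ∀ s ∈ halfPlane (1 / 2), f.eval s = g.eval s) : f = g := by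
  have key : ∀ f : HardyDirichlet,
      LSeries.abscissaOfAbsConv (fun n => if h : 0 < n then f ⟨n, h⟩ else 0) < ⊤ := by
    intro f
    refine lt_of_le_of_lt (LSeries.abscissaOfAbsConv_le_of_le_const
      ⟨‖f‖, fun n hn => ?_⟩) (by exact_mod_cast EReal.coe_lt_top 1)
    rw [dif_pos (Nat.pos_of_ne_zero hn)]
    exact lp.norm_apply_le_norm (by norm_num) f _
  have h2 := (LSeries_eventually_eq_zero_iff' (f := (fun n => if h : 0 < n then
    (f - g : HardyDirichlet) ⟨n, h⟩ else 0))).mp ?_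
  · rcases h2 with h2 | h2
    · rw [← sub_eq_zero]
      ext n
      have := h2 n n.pos.ne'
      rw [dif_pos n.pos] at this
      exact this
    · exact absurd h2 (key _).ne
  · filter_upwards [Filter.eventually_gt_atTop (1 : ℝ)] with x hx
    have hs : ∀ f : HardyDirichlet,
        LSeriesSummable (fun n => if h : 0 < n then f ⟨n, h⟩ else 0) x := by
      intro f
      refine LSeriesSummable_of_bounded_of_one_lt_re (m := ‖f‖) (fun n hn => ?_) (by simpa using hx)
      rw [dif_pos (Nat.pos_of_ne_zero hn)]
      exact lp.norm_apply_le_norm (by norm_num) f _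
    have e := h x (by show (1 / 2 : ℝ) < (x : ℂ).re; rw [Complex.ofReal_re]; linarith)
    rw [eval_eq_LSeries, eval_eq_LSeries] at e
    have : (fun n => if h : 0 < n then (f - g : HardyDirichlet) ⟨n, h⟩ else 0) =
        (fun n => if h : 0 < n then f ⟨n, h⟩ else 0) -
        (fun n => if h : 0 < n then g ⟨n, h⟩ else 0) := by
      ext n
      by_cases hn : 0 < n
      · simp only [hn, dite_true, Pi.sub_apply]
        rfl
      · simp [hn]
    rw [this, LSeries_sub (hs f) (hs g), e, sub_self]
    rfl

end HardyDirichlet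

/-- `C_φ` is uniquely determined by `φ`. -/
theorem IsCompositionOperator.unique {φ : ℂ → ℂ} {T T' : HardyDirichlet →L[ℂ] HardyDirichlet}
    (h : IsCompositionOperator φ T) (h' : IsCompositionOperator φ T') : T = T' :=
  ContinuousLinearMap.ext fun f =>
    HardyDirichlet.eq_of_eval_eq fun s hs => (h f s hs).trans (h' f s hs).symm

/-! The engine is a positive harmonic majorant. For a Dirichlet polynomial `P(w) = ∑ a_n n^(-w)` and
`Re w > 0`, give the squared tails `|∑_{n > k} a_n n^(-w)|²` the weights `(k+1)^(2 Re w) - k^(2 Re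
w)` and add. The result dominates `|P(w)|²`. Expanded, it is `∑ |a_n|²` plus terms that are constant
multiples of `(n/m)^w` or its conjugate with `n < m`, so it is harmonic. Along `φ(s) = c₀ s + ψ(s)`
with `c₀ ≥ 1`, every `(n/m)^φ` has only nonzero frequencies on vertical lines, hence mean value
zero, and the majorant has mean exactly `∑ |a_n|²` (`hasMean_majorant`). So a pointwise bound of
`|F|²` by majorants along symbols puts `F` in the Hardy space with a norm bound (`exists_eval_eq`);
for `F = P ∘ φ` this gives boundedness. Abel summation and Cauchy–Schwarz, with the same weights,
give `|P(w) - P(w')|² ≤ |w - w'|² / (4 (Re w)²)` times the majorant at `w` when `Re w ≤ Re w'`.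
Hence `|φ - φ'| ≤ K min(Re φ, Re φ')` implies `‖C_φ - C_φ'‖ ≤ 2K` (`norm_sub_le_of_norm_sub_le`). On
the segment from `φ₀` to `φ₁` this makes the operators depend on the parameter in a Lipschitz way,
which gives a path of composition operators. For compactness (`isCompactOperator_sub_of_isLittleO`),
the low frequencies are split off by a finite rank projection. On the remaining ones the difference
is small near the boundary by the little-o assumption, and elsewhere because `|P|²` is at most
`(N+1)^(-2 Re w)` times the majorant. -/

/-! ### Mean values of continuous functions on the line. -/

/-- The continuous function `g` on the line has mean value `m`. -/
structure HasMean (g : ℝ → ℂ) (m : ℂ) : Prop where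
  cont : Continuous g
  lim : Tendsto (fun T : ℝ => ((2 * T : ℝ) : ℂ)⁻¹ * ∫ t in (-T)..T, g t) atTop (𝓝 m)

namespace HasMean

theorem const (c : ℂ) : HasMean (fun _ => c) c := by
  refine ⟨continuous_const, tendsto_const_nhds.congr' ?_⟩
  filter_upwards [eventually_gt_atTop 0] with T hT
  have : (T : ℂ) ≠ 0 := by exact_mod_cast hT.ne'
  rw [intervalIntegral.integral_const, Complex.real_smul]
  push_cast
  field_simp
  ring

theorem add {g h : ℝ → ℂ} {m n : ℂ} (hg : HasMean g m) (hh : HasMean h n) :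
    HasMean (fun t => g t + h t) (m + n) := by
  refine ⟨hg.cont.add hh.cont, (hg.lim.add hh.lim).congr fun T => ?_⟩
  rw [intervalIntegral.integral_add (hg.cont.intervalIntegrable _ _)
    (hh.cont.intervalIntegrable _ _), mul_add]

theorem const_mul {g : ℝ → ℂ} {m : ℂ} (c : ℂ) (hg : HasMean g m) :
    HasMean (fun t => c * g t) (c * m) := by
  refine ⟨continuous_const.mul hg.cont, (hg.lim.const_mul c).congr fun T => ?_⟩
  rw [intervalIntegral.integral_const_mul]
  ring

theorem conj {g : ℝ → ℂ} {m : ℂ} (hg : HasMean g m) :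
    HasMean (fun t => (starRingEnd ℂ) (g t)) ((starRingEnd ℂ) m) := by
  refine ⟨Complex.continuous_conj.comp hg.cont,
    ((Complex.continuous_conj.tendsto m).comp hg.lim).congr fun T => ?_⟩
  simp only [Function.comp, map_mul, map_inv₀, Complex.conj_ofReal]
  congr 1
  exact ((Complex.conjCLE : ℂ →L[ℝ] ℂ).intervalIntegral_comp_comm
    (hg.cont.intervalIntegrable _ _)).symm

theorem sum {ι : Type*} (s : Finset ι) {g : ι → ℝ → ℂ} {m : ι → ℂ}
    (h : ∀ i ∈ s, HasMean (g i) (m i)) : HasMean (fun t => ∑ i ∈ s, g i t) (∑ i ∈ s, m i) := by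
  classical
  induction s using Finset.induction_on with
  | empty => simpa using const 0
  | insert i s hi ih =>
    simp only [Finset.sum_insert hi]
    exact (h i (by simp)).add (ih fun j hj => h j (by simp [hj]))

theorem exp {μ : ℝ} (hμ : μ ≠ 0) : HasMean (fun t => Complex.exp (μ * Complex.I * t)) 0 := by
  refine ⟨by fun_prop, ?_⟩
  have hc : (μ * Complex.I : ℂ) ≠ 0 := by simp [hμ]
  rw [tendsto_zero_iff_norm_tendsto_zero]
  refine squeeze_zero' (Eventually.of_forall fun _ => norm_nonneg _)
    (g := fun T : ℝ => |μ|⁻¹ * T⁻¹) ?_ (by simpa using tendsto_inv_atTop_zero.const_mul |μ|⁻¹)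
  filter_upwards [eventually_gt_atTop 0] with T hT
  have h1 : ∀ y : ℝ, ‖Complex.exp (μ * Complex.I * y)‖ = 1 := fun y => by
    rw [show (μ * Complex.I * y : ℂ) = ((μ * y : ℝ) : ℂ) * Complex.I by push_cast; ring,
      Complex.norm_exp_ofReal_mul_I]
  rw [integral_exp_mul_complex hc, norm_mul, norm_div, norm_inv, norm_mul, Complex.norm_I,
    Complex.norm_real, Complex.norm_real, Real.norm_eq_abs, Real.norm_eq_abs, mul_one,
    abs_of_pos (by positivity : 0 < 2 * T)]
  have h2 := norm_sub_le (Complex.exp (μ * Complex.I * T)) (Complex.exp (μ * Complex.I * (-T : ℝ)))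
  rw [h1, h1] at h2
  have hμ' : 0 < |μ| := abs_pos.mpr hμ
  calc _ ≤ (2 * T)⁻¹ * (2 / |μ|) := by gcongr; linarith
    _ = _ := by field_simp

/-- Averaging is a contraction for the sup norm, so mean values pass to uniform limits; this
transfers them from exponential sums to almost periodic functions. -/
theorem of_approx {g : ℝ → ℂ} {m : ℂ} (h : ∀ η > 0, ∃ g' m', HasMean g' m' ∧
    (∀ t, ‖g t - g' t‖ ≤ η) ∧ ‖m - m'‖ ≤ η) : HasMean g m := by
  have hc : Continuous g := by
    refine continuous_of_uniform_approx_of_continuous fun u hu => ?_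
    obtain ⟨ε, hε, hεu⟩ := Metric.mem_uniformity_dist.mp hu
    obtain ⟨g', m', hg', h1, -⟩ := h (ε / 2) (by positivity)
    exact ⟨g', hg'.cont, fun y => hεu (by rw [dist_eq_norm]; linarith [h1 y])⟩
  refine ⟨hc, Metric.tendsto_atTop.mpr fun ε hε => ?_⟩
  obtain ⟨g', m', hg', h1, h2⟩ := h (ε / 4) (by positivity)
  obtain ⟨T₀, hT₀⟩ := Metric.tendsto_atTop.mp hg'.lim (ε / 4) (by positivity)
  refine ⟨max T₀ 1, fun T hT => ?_⟩
  have hT1 : 0 < T := by linarith [le_max_right T₀ 1]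
  have h3 := hT₀ T ((le_max_left _ _).trans hT)
  rw [dist_eq_norm] at h3 ⊢
  have h4 : ‖((2 * T : ℝ) : ℂ)⁻¹ * (∫ t in (-T)..T, g t) -
      ((2 * T : ℝ) : ℂ)⁻¹ * ∫ t in (-T)..T, g' t‖ ≤ ε / 4 := by
    rw [← mul_sub, ← intervalIntegral.integral_sub (hc.intervalIntegrable _ _)
      (hg'.cont.intervalIntegrable _ _), norm_mul, norm_inv, Complex.norm_real, Real.norm_eq_abs,
      abs_of_pos (by positivity)]
    have := intervalIntegral.norm_integral_le_of_norm_le_const (a := -T) (b := T)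
      (f := fun t => g t - g' t) (C := ε / 4) (fun t _ => h1 t)
    rw [show T - -T = 2 * T by ring, abs_of_pos (by positivity)] at this
    rw [inv_mul_le_iff₀ (by positivity)]
    linarith
  rw [norm_sub_rev] at h2
  rw [← norm_neg] at h3 h4
  have := norm_add₃_le (a := ((2 * T : ℝ) : ℂ)⁻¹ * (∫ t in (-T)..T, g t) -
      ((2 * T : ℝ) : ℂ)⁻¹ * ∫ t in (-T)..T, g' t)
      (b := ((2 * T : ℝ) : ℂ)⁻¹ * (∫ t in (-T)..T, g' t) - m') (c := m' - m)
  rw [norm_neg] at h3 h4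
  simp only [sub_add_sub_cancel] at this
  linarith

theorem re_nonneg {g : ℝ → ℂ} {m : ℂ} (hg : HasMean g m) (h : ∀ t, 0 ≤ (g t).re) : 0 ≤ m.re := by
  refine ge_of_tendsto ((Complex.continuous_re.tendsto m).comp hg.lim) ?_
  filter_upwards [eventually_gt_atTop 0] with T hT
  have h1 : (∫ t in (-T)..T, g t).re = ∫ t in (-T)..T, (g t).re :=
    (Complex.reCLM.intervalIntegral_comp_comm (hg.cont.intervalIntegrable _ _)).symm
  simp only [Function.comp]
  rw [← Complex.ofReal_inv, Complex.re_ofReal_mul, h1]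
  exact mul_nonneg (by positivity) (intervalIntegral.integral_nonneg (by linarith) fun t _ => h t)

theorem re_mono {g h : ℝ → ℂ} {m n : ℂ} (hg : HasMean g m) (hh : HasMean h n)
    (hle : ∀ t, (g t).re ≤ (h t).re) : m.re ≤ n.re := by
  have := (hh.add (hg.const_mul (-1))).re_nonneg fun t => by simpa using hle t
  simpa using this

end HasMean

/-! ### Dirichlet polynomials and their mean squares on vertical lines. -/

theorem natCast_cpow_neg_eq_exp (n : ℕ+) (s : ℂ) :
    ((n : ℕ) : ℂ) ^ (-s) = Complex.exp (-(Real.log n * s)) := by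
  rw [Complex.cpow_def_of_ne_zero (by simp), ← Complex.natCast_log]
  congr 1
  ring

theorem norm_natCast_cpow_neg (n : ℕ+) (s : ℂ) :
    ‖((n : ℕ) : ℂ) ^ (-s)‖ = ((n : ℕ) : ℝ) ^ (-s.re) := by
  rw [Complex.norm_natCast_cpow_of_pos n.pos, Complex.neg_re]

/-- The value at `s` of the Dirichlet polynomial with coefficients `a`. -/
noncomputable def dirichletPoly (s : ℂ) : (ℕ+ →₀ ℂ) →ₗ[ℂ] ℂ :=
  Finsupp.linearCombination ℂ fun n : ℕ+ => ((n : ℕ) : ℂ) ^ (-s)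

theorem dirichletPoly_apply (s : ℂ) (a : ℕ+ →₀ ℂ) :
    dirichletPoly s a = ∑ n ∈ a.support, a n * ((n : ℕ) : ℂ) ^ (-s) := rfl

theorem dirichletPoly_single (s : ℂ) (n : ℕ+) (c : ℂ) :
    dirichletPoly s (Finsupp.single n c) = c * ((n : ℕ) : ℂ) ^ (-s) := by
  simp [dirichletPoly]

theorem norm_dirichletPoly_le {s : ℂ} (hs : 0 ≤ s.re) (a : ℕ+ →₀ ℂ) :
    ‖dirichletPoly s a‖ ≤ ∑ n ∈ a.support, ‖a n‖ := by
  rw [dirichletPoly_apply]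
  refine norm_sum_le_of_le _ fun n _ => ?_
  rw [norm_mul, norm_natCast_cpow_neg]
  refine mul_le_of_le_one_right (norm_nonneg _) (Real.rpow_le_one_of_one_le_of_nonpos ?_ ?_)
  · exact_mod_cast n.pos
  · linarith

theorem exists_dirichletPoly_mul (a b : ℕ+ →₀ ℂ) :
    ∃ c, ∀ s, dirichletPoly s c = dirichletPoly s a * dirichletPoly s b := by
  refine ⟨a.sum fun n x => b.sum fun m y => Finsupp.single (n * m) (x * y), fun s => ?_⟩
  simp only [Finsupp.sum, map_sum, dirichletPoly_single]
  rw [dirichletPoly_apply, dirichletPoly_apply, Finset.sum_mul_sum]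
  refine Finset.sum_congr rfl fun n _ => Finset.sum_congr rfl fun m _ => ?_
  rw [PNat.mul_coe, Nat.cast_mul, Complex.natCast_mul_natCast_cpow]
  ring

namespace HardyDirichlet

/-- The Dirichlet polynomial `s ↦ ∑ a n * n ^ (-(s + σ))` as an element of the Hardy space. -/
noncomputable def ofPoly (σ : ℝ) : (ℕ+ →₀ ℂ) →ₗ[ℂ] HardyDirichlet :=
  Finsupp.linearCombination ℂ fun n : ℕ+ => ((n : ℕ) : ℂ) ^ (-(σ : ℂ)) • lp.single 2 n (1 : ℂ)

theorem ofPoly_apply (σ : ℝ) (a : ℕ+ →₀ ℂ) (n : ℕ+) :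
    ofPoly σ a n = a n * ((n : ℕ) : ℂ) ^ (-(σ : ℂ)) := by
  rw [ofPoly, Finsupp.linearCombination_apply, Finsupp.sum, lp.coeFn_sum, Finset.sum_apply]
  simp only [lp.coeFn_smul, Pi.smul_apply, lp.single_apply, smul_eq_mul]
  rw [Finset.sum_eq_single n]
  · simp
  · intro m _ hm
    simp [hm]
  · intro h
    simp [Finsupp.notMem_support_iff.mp h]

theorem ofPoly_zero_apply (a : ℕ+ →₀ ℂ) (n : ℕ+) : ofPoly 0 a n = a n := by
  simp [ofPoly_apply]

theorem norm_sq_eq_tsum (f : HardyDirichlet) : ‖f‖ ^ 2 = ∑' n, ‖f n‖ ^ 2 := by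
  have := lp.norm_rpow_eq_tsum (p := 2) (by norm_num) f
  simpa using this

theorem norm_ofPoly_sq (σ : ℝ) (a : ℕ+ →₀ ℂ) :
    ‖ofPoly σ a‖ ^ 2 = ∑ n ∈ a.support, ‖a n * ((n : ℕ) : ℂ) ^ (-(σ : ℂ))‖ ^ 2 := by
  rw [norm_sq_eq_tsum, tsum_eq_sum (s := a.support)]
  · simp only [ofPoly_apply]
  · intro n hn
    simp [ofPoly_apply, Finsupp.notMem_support_iff.mp hn]

theorem denseRange_ofPoly_zero : DenseRange (ofPoly 0) := by
  intro f
  refine mem_closure_of_tendsto (lp.hasSum_single (by norm_num) f) (Eventually.of_forall fun S => ?_)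
  refine ⟨∑ n ∈ S, Finsupp.single n (f n), ?_⟩
  rw [map_sum]
  refine Finset.sum_congr rfl fun n _ => ?_
  ext m
  rw [ofPoly_zero_apply, lp.single_apply, Finsupp.single_apply]
  by_cases h : n = m
  · subst h; simp
  · simp [h, Ne.symm h]

/-- These are the coefficients of the reproducing kernel at `s`, conjugated because the inner
product is conjugate linear in its first argument. -/
theorem memℓp_conj_cpow {s : ℂ} (hs : s ∈ halfPlane (1 / 2)) :
    Memℓp (fun n : ℕ+ => (starRingEnd ℂ) (((n : ℕ) : ℂ) ^ (-s))) 2 := by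
  refine memℓp_gen ?_
  simp only [RCLike.norm_conj, norm_natCast_cpow_neg]
  have h : Summable fun n : ℕ => (n : ℝ) ^ (-(2 * s.re)) := by
    rw [Real.summable_nat_rpow]
    have : (1 / 2 : ℝ) < s.re := hs
    linarith
  refine (h.comp_injective PNat.coe_injective).congr fun n => ?_
  simp only [Function.comp]
  rw [← Real.rpow_mul (by positivity)]
  congr 1
  norm_num
  ring

/-- Evaluation at a point of the half-plane `1 / 2 < s.re` is continuous. -/
theorem exists_evalCLM {s : ℂ} (hs : s ∈ halfPlane (1 / 2)) :
    ∃ e : HardyDirichlet →L[ℂ] ℂ, ∀ f, e f = f.eval s := by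
  refine ⟨innerSL ℂ (⟨_, memℓp_conj_cpow hs⟩ : HardyDirichlet), fun f => ?_⟩
  rw [innerSL_apply_apply, lp.inner_eq_tsum]
  refine tsum_congr fun n => ?_
  simp [mul_comm]

theorem eval_ofPoly (σ : ℝ) (a : ℕ+ →₀ ℂ) (s : ℂ) :
    (ofPoly σ a).eval s = dirichletPoly (s + σ) a := by
  rw [eval, dirichletPoly_apply, tsum_eq_sum (s := a.support)]
  · refine Finset.sum_congr rfl fun n _ => ?_
    rw [ofPoly_apply, mul_assoc, ← Complex.cpow_add _ _ (by simp)]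
    congr 2
    ring
  · intro n hn
    simp [ofPoly_apply, Finsupp.notMem_support_iff.mp hn]

end HardyDirichlet

theorem dirichletPoly_add_mul_conj (a : ℕ+ →₀ ℂ) (σ : ℝ) (n m : ℕ+) (t : ℝ) :
    (a n * ((n : ℕ) : ℂ) ^ (-(σ + t * Complex.I))) *
      (starRingEnd ℂ) (a m * ((m : ℕ) : ℂ) ^ (-(σ + t * Complex.I))) =
    (a n * ((n : ℕ) : ℂ) ^ (-(σ : ℂ))) * (starRingEnd ℂ) (a m * ((m : ℕ) : ℂ) ^ (-(σ : ℂ))) *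
      Complex.exp ((Real.log m - Real.log n : ℝ) * Complex.I * t) := by
  simp only [map_mul, natCast_cpow_neg_eq_exp, ← Complex.exp_conj, map_neg, map_add,
    Complex.conj_ofReal, Complex.conj_I]
  rw [show ∀ x y z w : ℂ, x * y * (z * w) = x * z * (y * w) from fun _ _ _ _ => by ring,
    show ∀ x y z w v : ℂ, x * y * (z * w) * v = x * z * (y * w * v) from fun _ _ _ _ _ => by ring,
    ← Complex.exp_add, ← Complex.exp_add, ← Complex.exp_add]
  congr 2
  push_cast
  ring

/-- Orthogonality (Carlson's formula): the product of the `n`-th and conjugated `m`-th terms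
oscillates with frequency `log m - log n`, which vanishes only if `n = m`, so only the diagonal
survives averaging. -/
theorem hasMean_norm_dirichletPoly_sq (σ : ℝ) (a : ℕ+ →₀ ℂ) :
    HasMean (fun t => ((‖dirichletPoly (σ + t * Complex.I) a‖ ^ 2 : ℝ) : ℂ))
      ((‖HardyDirichlet.ofPoly σ a‖ ^ 2 : ℝ) : ℂ) := by
  have h : ∀ n ∈ a.support, HasMean (fun t : ℝ => ∑ m ∈ a.support,
      (a n * ((n : ℕ) : ℂ) ^ (-(σ : ℂ))) * (starRingEnd ℂ) (a m * ((m : ℕ) : ℂ) ^ (-(σ : ℂ))) *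
        Complex.exp ((Real.log m - Real.log n : ℝ) * Complex.I * t))
      ((‖a n * ((n : ℕ) : ℂ) ^ (-(σ : ℂ))‖ ^ 2 : ℝ) : ℂ) := by
    intro n hn
    have := HasMean.sum a.support (g := fun (m : ℕ+) (t : ℝ) =>
      (a n * ((n : ℕ) : ℂ) ^ (-(σ : ℂ))) * (starRingEnd ℂ) (a m * ((m : ℕ) : ℂ) ^ (-(σ : ℂ))) *
        Complex.exp ((Real.log m - Real.log n : ℝ) * Complex.I * t))
      (m := fun m => if m = n then ((‖a n * ((n : ℕ) : ℂ) ^ (-(σ : ℂ))‖ ^ 2 : ℝ) : ℂ) else 0)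
      fun m _ => ?_
    · simpa [Finset.sum_ite_eq', hn] using this
    · split_ifs with hmn
      · subst hmn
        convert HasMean.const _ using 2
        rw [Complex.mul_conj']
        simp
      · have hl : Real.log m - Real.log n ≠ 0 := by
          rw [sub_ne_zero]
          intro h
          have h' := Real.log_injOn_pos (Set.mem_Ioi.mpr (by simp)) (Set.mem_Ioi.mpr (by simp)) h
          exact hmn (PNat.coe_injective (by exact_mod_cast h'))
        simpa using (HasMean.exp hl).const_mul _
  have h2 := HasMean.sum a.support h
  rw [HardyDirichlet.norm_ofPoly_sq]
  push_cast at h2 ⊢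
  convert h2 using 2 with t
  rw [← Complex.mul_conj', dirichletPoly_apply, map_sum, Finset.sum_mul_sum]
  refine Finset.sum_congr rfl fun n _ => Finset.sum_congr rfl fun m _ => ?_
  rw [dirichletPoly_add_mul_conj]
  push_cast
  rfl

/-! ### Uniform limits of Dirichlet polynomials. -/

/-- `F` is, in each half-plane `ε < s.re` with `0 < ε`, a uniform limit of Dirichlet polynomials. -/
def IsUniformDirichlet (F : ℂ → ℂ) : Prop :=
  ∀ ε : ℝ, 0 < ε → ∀ η : ℝ, 0 < η → ∃ a : ℕ+ →₀ ℂ, ∀ s ∈ halfPlane ε, ‖F s - dirichletPoly s a‖ ≤ η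

namespace IsUniformDirichlet

theorem of_dirichletPoly (a : ℕ+ →₀ ℂ) : IsUniformDirichlet fun s => dirichletPoly s a :=
  fun _ _ η hη => ⟨a, fun s _ => by simpa using hη.le⟩

theorem cpow (n : ℕ+) : IsUniformDirichlet fun s => ((n : ℕ) : ℂ) ^ (-s) := by
  simpa [dirichletPoly_single] using of_dirichletPoly (Finsupp.single n 1)

theorem const (c : ℂ) : IsUniformDirichlet fun _ => c := by
  simpa [dirichletPoly_single] using of_dirichletPoly (Finsupp.single 1 c)

theorem bounded {F : ℂ → ℂ} (hF : IsUniformDirichlet F) {ε : ℝ} (hε : 0 < ε) :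
    ∃ B : ℝ, 0 < B ∧ ∀ s ∈ halfPlane ε, ‖F s‖ ≤ B := by
  obtain ⟨a, ha⟩ := hF ε hε 1 one_pos
  refine ⟨1 + ∑ n ∈ a.support, ‖a n‖, by positivity, fun s hs => ?_⟩
  have h1 := norm_dirichletPoly_le (hε.le.trans (le_of_lt hs)) a
  have h2 := norm_sub_norm_le (F s) (dirichletPoly s a)
  linarith [ha s hs]

theorem add {F G : ℂ → ℂ} (hF : IsUniformDirichlet F) (hG : IsUniformDirichlet G) :
    IsUniformDirichlet fun s => F s + G s := by
  intro ε hε η hη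
  obtain ⟨a, ha⟩ := hF ε hε (η / 2) (by positivity)
  obtain ⟨b, hb⟩ := hG ε hε (η / 2) (by positivity)
  refine ⟨a + b, fun s hs => ?_⟩
  rw [map_add, add_sub_add_comm]
  linarith [norm_add_le (F s - dirichletPoly s a) (G s - dirichletPoly s b), ha s hs, hb s hs]

theorem mul {F G : ℂ → ℂ} (hF : IsUniformDirichlet F) (hG : IsUniformDirichlet G) :
    IsUniformDirichlet fun s => F s * G s := by
  intro ε hε η hη
  obtain ⟨A, hA, hFA⟩ := hF.bounded hε
  obtain ⟨b, hb⟩ := hG ε hε (η / (2 * A)) (by positivity)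
  obtain ⟨B, hB, hbB⟩ := (of_dirichletPoly b).bounded hε
  obtain ⟨a, ha⟩ := hF ε hε (η / (2 * B)) (by positivity)
  obtain ⟨c, hc⟩ := exists_dirichletPoly_mul a b
  refine ⟨c, fun s hs => ?_⟩
  rw [hc, show F s * G s - dirichletPoly s a * dirichletPoly s b =
    F s * (G s - dirichletPoly s b) + (F s - dirichletPoly s a) * dirichletPoly s b by ring]
  refine (norm_add_le _ _).trans ?_
  rw [norm_mul, norm_mul]
  calc _ ≤ A * (η / (2 * A)) + η / (2 * B) * B := by
        gcongr
        exacts [hFA s hs, hb s hs, ha s hs, hbB s hs]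
    _ = η := by field_simp; ring

theorem pow {F : ℂ → ℂ} (hF : IsUniformDirichlet F) (k : ℕ) :
    IsUniformDirichlet fun s => F s ^ k := by
  induction k with
  | zero => simpa using const 1
  | succ k ih => simpa only [pow_succ] using ih.mul hF

theorem sum {ι : Type*} (S : Finset ι) {F : ι → ℂ → ℂ} (h : ∀ i ∈ S, IsUniformDirichlet (F i)) :
    IsUniformDirichlet fun s => ∑ i ∈ S, F i s := by
  classical
  induction S using Finset.induction_on with
  | empty => simpa using const 0
  | insert i S hi ih =>
    simp only [Finset.sum_insert hi]
    exact (h i (by simp)).add (ih fun j hj => h j (by simp [hj]))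

theorem of_approx {F : ℂ → ℂ} (h : ∀ ε : ℝ, 0 < ε → ∀ η : ℝ, 0 < η → ∃ G, IsUniformDirichlet G ∧
    ∀ s ∈ halfPlane ε, ‖F s - G s‖ ≤ η) : IsUniformDirichlet F := by
  intro ε hε η hη
  obtain ⟨G, hG, hFG⟩ := h ε hε (η / 2) (by positivity)
  obtain ⟨a, ha⟩ := hG ε hε (η / 2) (by positivity)
  refine ⟨a, fun s hs => ?_⟩
  have := norm_add_le (F s - G s) (G s - dirichletPoly s a)
  rw [sub_add_sub_cancel] at this
  linarith [hFG s hs, ha s hs]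

theorem exp {F : ℂ → ℂ} (hF : IsUniformDirichlet F) :
    IsUniformDirichlet fun s => Complex.exp (F s) := by
  refine of_approx fun ε hε η hη => ?_
  obtain ⟨B, hB, hFB⟩ := hF.bounded hε
  have hsum : Tendsto (fun k : ℕ => ∑ i ∈ Finset.range k, B ^ i / (i.factorial : ℝ)) atTop
      (𝓝 (Real.exp B)) := by
    rw [Real.exp_eq_exp_ℝ]
    exact (NormedSpace.expSeries_div_hasSum_exp B).tendsto_sum_nat
  obtain ⟨k, hk⟩ := (Metric.tendsto_atTop.mp hsum η hη)
  refine ⟨fun s => ∑ i ∈ Finset.range k, F s ^ i * (((i.factorial : ℂ))⁻¹),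
    sum _ fun i _ => (hF.pow i).mul (const _), fun s hs => ?_⟩
  have hk' := (abs_lt.mp (Real.dist_eq _ _ ▸ hk k le_rfl)).1
  simp only [← div_eq_mul_inv]
  have hz : HasSum (fun i : ℕ => F s ^ (i + k) / ((i + k).factorial : ℂ))
      (Complex.exp (F s) - ∑ i ∈ Finset.range k, F s ^ i / (i.factorial : ℂ)) := by
    rw [Complex.exp_eq_exp_ℂ]
    exact (hasSum_nat_add_iff' k).mpr (NormedSpace.expSeries_div_hasSum_exp (F s))
  have hr : HasSum (fun i : ℕ => B ^ (i + k) / ((i + k).factorial : ℝ))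
      (Real.exp B - ∑ i ∈ Finset.range k, B ^ i / (i.factorial : ℝ)) := by
    rw [Real.exp_eq_exp_ℝ]
    exact (hasSum_nat_add_iff' k).mpr (NormedSpace.expSeries_div_hasSum_exp B)
  -- The Taylor remainder at `F s` is dominated by that of the real exponential at the bound `B`,
  -- uniformly in `s`.
  have h3 : ‖Complex.exp (F s) - ∑ i ∈ Finset.range k, F s ^ i / (i.factorial : ℂ)‖ ≤
      Real.exp B - ∑ i ∈ Finset.range k, B ^ i / (i.factorial : ℝ) := by
    rw [← hz.tsum_eq]
    refine tsum_of_norm_bounded hr fun i => ?_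
    rw [norm_div, norm_pow, Complex.norm_natCast]
    gcongr
    exact hFB s hs
  linarith

/-- The product of `F` with a decaying exponential has mean value `0` on vertical lines. -/
theorem hasMean_exp_mul {F : ℂ → ℂ} (hF : IsUniformDirichlet F) {μ σ : ℝ} (hμ : 0 < μ)
    (hσ : 0 < σ) :
    HasMean (fun t => Complex.exp (-(μ * (σ + t * Complex.I))) * F (σ + t * Complex.I)) 0 := by
  refine HasMean.of_approx fun η hη => ?_
  obtain ⟨a, ha⟩ := hF (σ / 2) (by positivity) η hη
  refine ⟨fun t => ∑ n ∈ a.support, a n * Complex.exp (-((μ + Real.log n) * σ)) *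
    Complex.exp ((-(μ + Real.log n) : ℝ) * Complex.I * t), 0, ?_, fun t => ?_, by simpa using hη.le⟩
  · have := HasMean.sum a.support (m := fun _ => 0) (g := fun (n : ℕ+) (t : ℝ) =>
      a n * Complex.exp (-((μ + Real.log n) * σ)) *
        Complex.exp ((-(μ + Real.log n) : ℝ) * Complex.I * t)) fun n _ => ?_
    · simpa only [Finset.sum_const_zero] using this
    -- Since `μ > 0` and `log n ≥ 0`, no frequency vanishes, not even for `n = 1`.
    · have hn : (-(μ + Real.log n) : ℝ) ≠ 0 := by
        have : 0 ≤ Real.log n := Real.log_natCast_nonneg _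
        exact (neg_neg_of_pos (by positivity)).ne
      simpa using (HasMean.exp hn).const_mul (a n * Complex.exp (-((μ + Real.log n) * σ)))
  · have h1 : ∑ n ∈ a.support, a n * Complex.exp (-((μ + Real.log n) * σ)) *
        Complex.exp ((-(μ + Real.log n) : ℝ) * Complex.I * t) =
        Complex.exp (-(μ * (σ + t * Complex.I))) * dirichletPoly (σ + t * Complex.I) a := by
      rw [dirichletPoly_apply, Finset.mul_sum]
      refine Finset.sum_congr rfl fun n _ => ?_
      rw [natCast_cpow_neg_eq_exp, mul_assoc, mul_left_comm _ (a n), ← Complex.exp_add,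
        ← Complex.exp_add]
      congr 2
      push_cast
      ring
    beta_reduce
    rw [h1, ← mul_sub, norm_mul, Complex.norm_exp]
    have h2 := ha (σ + t * Complex.I) (by simp [halfPlane]; linarith)
    refine (mul_le_of_le_one_left (norm_nonneg _) ?_).trans h2
    rw [Real.exp_le_one_iff]
    simp
    positivity

end IsUniformDirichlet

/-! ### Membership in the Hardy space from mean values on vertical lines. -/

namespace HardyDirichlet

theorem norm_ofPoly_le {σ c : ℝ} (hc : 0 ≤ c) {a : ℕ+ →₀ ℂ}
    (h : ∀ t : ℝ, ‖dirichletPoly (σ + t * Complex.I) a‖ ≤ c) : ‖ofPoly σ a‖ ≤ c := by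
  have := (hasMean_norm_dirichletPoly_sq σ a).re_mono (HasMean.const ((c ^ 2 : ℝ) : ℂ)) fun t => by
    rw [Complex.ofReal_re, Complex.ofReal_re]
    exact pow_le_pow_left₀ (norm_nonneg _) (h t) 2
  rw [Complex.ofReal_re, Complex.ofReal_re] at this
  exact (sq_le_sq₀ (norm_nonneg _) hc).mp this

theorem norm_ofPoly_sq_le {σ B η M : ℝ} {F : ℂ → ℂ} {a : ℕ+ →₀ ℂ} {G : ℝ → ℂ} {m : ℂ}
    (hG : HasMean G m) (hm : m.re ≤ M) (hFG : ∀ t : ℝ, ‖F (σ + t * Complex.I)‖ ^ 2 ≤ (G t).re)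
    (hB : ∀ t : ℝ, ‖F (σ + t * Complex.I)‖ ≤ B) (hη : 0 ≤ η)
    (ha : ∀ t : ℝ, ‖F (σ + t * Complex.I) - dirichletPoly (σ + t * Complex.I) a‖ ≤ η) :
    ‖ofPoly σ a‖ ^ 2 ≤ M + (2 * B * η + η ^ 2) := by
  have := (hasMean_norm_dirichletPoly_sq σ a).re_mono
    (hG.add (HasMean.const ((2 * B * η + η ^ 2 : ℝ) : ℂ))) fun t => ?_
  · rw [Complex.add_re, Complex.ofReal_re, Complex.ofReal_re] at this
    linarith
  · rw [Complex.add_re, Complex.ofReal_re, Complex.ofReal_re]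
    have h1 := norm_sub_norm_le (dirichletPoly (σ + t * Complex.I) a) (F (σ + t * Complex.I))
    rw [norm_sub_rev] at h1
    have h2 : ‖dirichletPoly (σ + t * Complex.I) a‖ ≤ ‖F (σ + t * Complex.I)‖ + η := by
      linarith [ha t]
    nlinarith [pow_le_pow_left₀ (norm_nonneg _) h2 2, hFG t,
      mul_le_mul_of_nonneg_right (hB t) hη]

theorem tendsto_apply {u : ℕ → HardyDirichlet} {f : HardyDirichlet} (h : Tendsto u atTop (𝓝 f))
    (n : ℕ+) : Tendsto (fun k => u k n) atTop (𝓝 (f n)) := by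
  rw [tendsto_iff_norm_sub_tendsto_zero] at h ⊢
  exact squeeze_zero (fun _ => norm_nonneg _)
    (fun k => lp.norm_apply_le_norm (by norm_num) (u k - f) n) h

/-- A uniform limit of Dirichlet polynomials whose square has a majorant of mean value at most `M`
on each vertical line in the right half-plane is the sum of an element of the Hardy space. -/
theorem exists_eval_eq {F : ℂ → ℂ} (hF : IsUniformDirichlet F) {M : ℝ}
    (h : ∀ σ : ℝ, 0 < σ → ∃ (G : ℝ → ℂ) (m : ℂ), HasMean G m ∧ m.re ≤ M ∧
      ∀ t : ℝ, ‖F (σ + t * Complex.I)‖ ^ 2 ≤ (G t).re) :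
    ∃ b : HardyDirichlet, ‖b‖ ^ 2 ≤ M ∧ ∀ s ∈ halfPlane (1 / 2), b.eval s = F s := by
  have hpos : ∀ k : ℕ, (0 : ℝ) < 1 / ((k : ℝ) + 1) := fun k => by positivity
  -- One sequence for all lines: `P k` is within `1 / (k + 1)` of `F` where `1 / (k + 1) < Re s`, so
  -- it converges uniformly on each `σ ≤ Re s` with `σ > 0`.
  choose P hP using fun k : ℕ => hF _ (hpos k) _ (hpos k)
  have hlim : Tendsto (fun k : ℕ => 1 / ((k : ℝ) + 1)) atTop (𝓝 0) :=
    tendsto_one_div_add_atTop_nhds_zero_nat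
  have hU : ∀ σ : ℝ, 0 < σ → ∀ᶠ k in atTop, ∀ s : ℂ, σ ≤ s.re →
      ‖F s - dirichletPoly s (P k)‖ ≤ 1 / ((k : ℝ) + 1) := by
    intro σ hσ
    filter_upwards [hlim.eventually_lt_const hσ] with k hk s hs
    exact hP k s (lt_of_lt_of_le hk hs)
  have hre : ∀ σ t : ℝ, (σ + t * Complex.I : ℂ).re = σ := by simp
  have hCauchy : ∀ σ : ℝ, 0 < σ → ∃ L, Tendsto (fun k => ofPoly σ (P k)) atTop (𝓝 L) := by
    intro σ hσ
    refine cauchySeq_tendsto_of_complete (Metric.cauchySeq_iff'.mpr fun ε hε => ?_)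
    obtain ⟨K, hK⟩ := eventually_atTop.mp
      ((hU σ hσ).and (hlim.eventually_lt_const (show 0 < ε / 3 by positivity)))
    refine ⟨K, fun k hk => ?_⟩
    rw [dist_eq_norm, ← map_sub]
    refine lt_of_le_of_lt (norm_ofPoly_le (c := 2 * (ε / 3)) (by positivity) fun t => ?_)
      (by linarith)
    have h1 := (hK k hk).1 _ (hre σ t).ge
    have h2 := (hK K le_rfl).1 _ (hre σ t).ge
    have h3 := norm_sub_le (F (σ + t * Complex.I) - dirichletPoly (σ + t * Complex.I) (P K))
      (F (σ + t * Complex.I) - dirichletPoly (σ + t * Complex.I) (P k))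
    rw [sub_sub_sub_cancel_left] at h3
    rw [map_sub]
    linarith [(hK k hk).2, (hK K le_rfl).2]
  choose! L hL using hCauchy
  have hcoef : ∀ σ : ℝ, 0 < σ → ∀ n, Tendsto (fun k => P k n) atTop
      (𝓝 (L σ n * ((n : ℕ) : ℂ) ^ (σ : ℂ))) := by
    intro σ hσ n
    refine ((tendsto_apply (hL σ hσ) n).mul_const (((n : ℕ) : ℂ) ^ (σ : ℂ))).congr fun k => ?_
    rw [ofPoly_apply, mul_assoc, ← Complex.cpow_add _ _ (by simp)]
    simp
  -- By `hcoef` the coefficients of `P k` converge to a limit independent of `σ`; taking `σ = 1`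
  -- here is arbitrary.
  obtain ⟨b, hb⟩ : ∃ b : ℕ+ → ℂ, ∀ n, b n = L 1 n * ((n : ℕ) : ℂ) ^ ((1 : ℝ) : ℂ) :=
    ⟨_, fun _ => rfl⟩
  have hLb : ∀ σ : ℝ, 0 < σ → ∀ n, L σ n = b n * ((n : ℕ) : ℂ) ^ (-(σ : ℂ)) := by
    intro σ hσ n
    rw [hb, tendsto_nhds_unique (hcoef 1 one_pos n) (hcoef σ hσ n), mul_assoc,
      ← Complex.cpow_add _ _ (by simp)]
    simp
  have hnorm : ∀ σ : ℝ, 0 < σ → ‖L σ‖ ^ 2 ≤ M := by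
    intro σ hσ
    obtain ⟨G, m, hG, hm, hFG⟩ := h σ hσ
    obtain ⟨B, -, hB⟩ := hF.bounded (half_pos hσ)
    have h1 : Tendsto (fun k : ℕ => M + (2 * B * (1 / ((k : ℝ) + 1)) + (1 / ((k : ℝ) + 1)) ^ 2))
        atTop (𝓝 (M + (2 * B * 0 + 0 ^ 2))) := by
      exact tendsto_const_nhds.add ((hlim.const_mul _).add (hlim.pow 2))
    rw [show M + (2 * B * 0 + 0 ^ 2) = M by ring] at h1
    refine le_of_tendsto_of_tendsto ((hL σ hσ).norm.pow 2) h1 ?_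
    filter_upwards [hU σ hσ] with k hk
    exact norm_ofPoly_sq_le hG hm hFG (fun t => hB _ (by simp [halfPlane]; linarith)) (hpos k).le
      fun t => hk _ (hre σ t).ge
  -- The bound on `L σ` is uniform in `σ`, so letting `σ → 0+` in finite sums bounds `b` itself.
  have hsum : ∀ S : Finset ℕ+, ∑ n ∈ S, ‖b n‖ ^ 2 ≤ M := by
    intro S
    have hc : Tendsto (fun σ : ℝ => ∑ n ∈ S, ‖b n * ((n : ℕ) : ℂ) ^ (-(σ : ℂ))‖ ^ 2) (𝓝[>] 0)
        (𝓝 (∑ n ∈ S, ‖b n * ((n : ℕ) : ℂ) ^ (-((0 : ℝ) : ℂ))‖ ^ 2)) := by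
      refine tendsto_finsetSum _ fun n _ => ?_
      simp only [natCast_cpow_neg_eq_exp]
      exact (Continuous.tendsto (by fun_prop) 0).mono_left nhdsWithin_le_nhds
    simp only [Complex.ofReal_zero, neg_zero, Complex.cpow_zero, mul_one] at hc
    refine le_of_tendsto hc (eventually_nhdsWithin_of_forall fun σ hσ => ?_)
    refine le_trans ?_ (hnorm σ hσ)
    have := lp.sum_rpow_le_norm_rpow (p := 2) (by norm_num) (L σ) S
    simpa [← hLb σ hσ] using this
  have hmem : Memℓp b 2 := memℓp_gen' (C := M) fun S => by simpa using hsum S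
  refine ⟨⟨b, hmem⟩, ?_, fun s hs => ?_⟩
  · rw [norm_sq_eq_tsum]
    have hs := hmem.summable (by norm_num)
    exact Summable.tsum_le_of_sum_le (by simpa using hs) hsum
  · have hs' : (1 / 2 : ℝ) < s.re := hs
    -- Half of the distance from `s` to the critical line: `s - σ` still admits continuous
    -- evaluation, and evaluating the shifted polynomials there returns `P k` at `s`.
    set σ : ℝ := (s.re - 1 / 2) / 2 with hσdef
    have hσ : 0 < σ := by rw [hσdef]; linarith
    obtain ⟨e, he⟩ := exists_evalCLM (s := s - σ)
      (show (1 / 2 : ℝ) < (s - σ).re by rw [Complex.sub_re, Complex.ofReal_re]; linarith)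
    have h1 := (e.continuous.tendsto _).comp (hL σ hσ)
    have h2 : Tendsto (fun k => dirichletPoly s (P k)) atTop (𝓝 (F s)) := by
      rw [tendsto_iff_norm_sub_tendsto_zero]
      refine squeeze_zero' (Eventually.of_forall fun _ => norm_nonneg _) ?_ hlim
      filter_upwards [hU σ hσ] with k hk
      rw [norm_sub_rev]
      exact hk s (by linarith)
    have h3 : ∀ k, (⇑e ∘ fun k => ofPoly σ (P k)) k = dirichletPoly s (P k) := fun k => by
      rw [Function.comp, he, eval_ofPoly, sub_add_cancel]
    rw [← tendsto_nhds_unique (h1.congr h3) h2, he]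
    refine tsum_congr fun n => ?_
    rw [hLb σ hσ, mul_assoc, ← Complex.cpow_add _ _ (by simp), neg_sub, ← add_sub_assoc,
      neg_add_cancel, zero_sub]

end HardyDirichlet

/-! ### Summation by parts and weighted tails. -/

/-- The right-hand side is `(2 sinh ((B - A) / 2))²`. With `A`, `B` consecutive values of `2x log
n`, one factor is a tail weight and the other telescopes. -/
theorem sq_sub_le_exp_sub_mul_exp_sub {A B : ℝ} (hAB : A ≤ B) :
    (B - A) ^ 2 ≤ (Real.exp B - Real.exp A) * (Real.exp (-A) - Real.exp (-B)) := by
  have h : (Real.exp B - Real.exp A) * (Real.exp (-A) - Real.exp (-B)) =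
      (2 * Real.sinh ((B - A) / 2)) ^ 2 := by
    have e1 : Real.exp B = Real.exp (B / 2) ^ 2 := by rw [← Real.exp_nat_mul]; ring_nf
    have e2 : Real.exp A = Real.exp (A / 2) ^ 2 := by rw [← Real.exp_nat_mul]; ring_nf
    have e3 : Real.exp ((B - A) / 2) = Real.exp (B / 2) / Real.exp (A / 2) := by
      rw [← Real.exp_sub]; ring_nf
    rw [Real.sinh_eq, Real.exp_neg, Real.exp_neg, Real.exp_neg, e1, e2, e3]
    have := (Real.exp_pos (A / 2)).ne'
    have := (Real.exp_pos (B / 2)).ne'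
    field_simp
  rw [h]
  have := Real.self_le_sinh_iff.mpr (show 0 ≤ (B - A) / 2 by linarith)
  exact pow_le_pow_left₀ (by linarith) (by linarith) 2

theorem norm_exp_sub_exp_le {a b : ℂ} (ha : a.re ≤ 0) (hb : b.re ≤ 0) :
    ‖Complex.exp a - Complex.exp b‖ ≤ ‖a - b‖ := by
  have := Convex.norm_image_sub_le_of_norm_deriv_le (f := Complex.exp) (C := 1)
    (s := {z : ℂ | z.re ≤ 0}) (x := b) (y := a) (fun z _ => Complex.differentiableAt_exp)
    (fun z hz => by
      rw [Complex.deriv_exp, Complex.norm_exp]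
      exact Real.exp_le_one_iff.mpr hz)
    (convex_halfSpace_re_le 0) hb ha
  simpa using this

theorem sum_range_mul_eq_sum_sub_mul_tail (z g : ℕ → ℂ) (hg : g 0 = 0) (N : ℕ) :
    ∑ j ∈ Finset.range N, z j * g j =
      ∑ k ∈ Finset.range N, (g (k + 1) - g k) * ∑ j ∈ Finset.Ico (k + 1) N, z j := by
  have h : ∀ j, z j * g j = ∑ k ∈ Finset.range j, (g (k + 1) - g k) * z j := fun j => by
    rw [← Finset.sum_mul, Finset.sum_range_sub, hg, sub_zero, mul_comm]
  simp only [h, Finset.mul_sum]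
  refine Finset.sum_comm' fun j k => ?_
  simp only [Finset.mem_range, Finset.mem_Ico]
  omega

/-- The sum of the squared tails `z k + ⋯ + z (N - 1)` with weights `(k + 1) ^ (2x) - k ^ (2x)`. -/
noncomputable def tailEnergy (x : ℝ) (z : ℕ → ℂ) (N : ℕ) : ℝ :=
  ∑ k ∈ Finset.range N, (((k : ℝ) + 1) ^ (2 * x) - (k : ℝ) ^ (2 * x)) *
    ‖∑ j ∈ Finset.Ico k N, z j‖ ^ 2

theorem weight_nonneg {x : ℝ} (hx : 0 < x) (k : ℕ) :
    0 ≤ ((k : ℝ) + 1) ^ (2 * x) - (k : ℝ) ^ (2 * x) :=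
  sub_nonneg.mpr (Real.rpow_le_rpow (by positivity) (by linarith) (by linarith))

theorem sum_range_weight {x : ℝ} (hx : 0 < x) (m : ℕ) :
    ∑ k ∈ Finset.range m, (((k : ℝ) + 1) ^ (2 * x) - (k : ℝ) ^ (2 * x)) = (m : ℝ) ^ (2 * x) := by
  have := Finset.sum_range_sub (fun k : ℕ => (k : ℝ) ^ (2 * x)) m
  push_cast at this
  rw [this, Real.zero_rpow (by positivity), sub_zero]

theorem tailEnergy_nonneg {x : ℝ} (hx : 0 < x) (z : ℕ → ℂ) (N : ℕ) : 0 ≤ tailEnergy x z N :=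
  Finset.sum_nonneg fun k _ => mul_nonneg (weight_nonneg hx k) (by positivity)

/-- The tails starting at `0, …, M` all equal the full sum, and their `M + 1` weights telescope to
`(M + 1) ^ (2x)`. -/
theorem rpow_mul_norm_sum_sq_le_tailEnergy {x : ℝ} (hx : 0 < x) {z : ℕ → ℂ} {M N : ℕ}
    (hz : ∀ j < M, z j = 0) :
    ((M : ℝ) + 1) ^ (2 * x) * ‖∑ j ∈ Finset.range N, z j‖ ^ 2 ≤ tailEnergy x z N := by
  rcases le_or_gt N M with h | h
  · rw [Finset.sum_eq_zero fun j hj => hz j ((Finset.mem_range.mp hj).trans_le h)]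
    simpa using tailEnergy_nonneg hx z N
  · have h1 : ∀ k ∈ Finset.range (M + 1),
        ∑ j ∈ Finset.Ico k N, z j = ∑ j ∈ Finset.range N, z j := by
      intro k hk
      rw [Finset.range_eq_Ico, ← Finset.sum_Ico_consecutive z (Nat.zero_le k)
        (by have := Finset.mem_range.mp hk; omega), Finset.sum_eq_zero (s := Finset.Ico 0 k),
        zero_add]
      intro j hj
      refine hz j ?_
      have := Finset.mem_range.mp hk
      have := Finset.mem_Ico.mp hj
      omega
    have h2 := sum_range_weight hx (M + 1)
    push_cast at h2
    rw [← h2, Finset.sum_mul]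
    calc _ = ∑ k ∈ Finset.range (M + 1), (((k : ℝ) + 1) ^ (2 * x) - (k : ℝ) ^ (2 * x)) *
          ‖∑ j ∈ Finset.Ico k N, z j‖ ^ 2 :=
          Finset.sum_congr rfl fun k hk => by rw [h1 k hk]
      _ ≤ _ := Finset.sum_le_sum_of_subset_of_nonneg (by simpa using h)
          fun k _ _ => mul_nonneg (weight_nonneg hx k) (by positivity)

/-- The pair `(i, j)` occurs in the squared tails with `k ≤ min i j`, whose weights telescope. For
`z j = a (j+1) ^ (-w)` and `x = Re w`, the factor `(min i j + 1) ^ (2x)` leaves each term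
holomorphic or antiholomorphic in `w`. -/
theorem tailEnergy_eq_sum_sum {x : ℝ} (hx : 0 < x) (z : ℕ → ℂ) (N : ℕ) :
    (tailEnergy x z N : ℂ) = ∑ i ∈ Finset.range N, ∑ j ∈ Finset.range N,
      ((((min i j : ℕ) : ℝ) + 1) ^ (2 * x) : ℝ) * (z i * (starRingEnd ℂ) (z j)) := by
  have h1 : ∀ i j : ℕ, ((((((min i j : ℕ) : ℝ) + 1) ^ (2 * x) : ℝ)) : ℂ) =
      ∑ k ∈ Finset.range (min i j + 1), ((((k : ℝ) + 1) ^ (2 * x) - (k : ℝ) ^ (2 * x) : ℝ) : ℂ) := by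
    intro i j
    rw [← Complex.ofReal_sum, sum_range_weight hx]
    push_cast
    rfl
  have h2 : ∀ k : ℕ, ((‖∑ j ∈ Finset.Ico k N, z j‖ ^ 2 : ℝ) : ℂ) =
      ∑ p ∈ Finset.Ico k N ×ˢ Finset.Ico k N, z p.1 * (starRingEnd ℂ) (z p.2) := by
    intro k
    push_cast
    rw [← Complex.mul_conj', map_sum, Finset.sum_mul_sum, Finset.sum_product]
  simp only [h1, tailEnergy, Complex.ofReal_sum, Complex.ofReal_mul, h2, Finset.mul_sum,
    Finset.sum_mul]
  rw [← Finset.sum_product']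
  refine Finset.sum_comm' fun k p => ?_
  simp only [Finset.mem_range, Finset.mem_Ico, Finset.mem_product]
  omega

theorem norm_sum_mul_sq_le_tailEnergy {x D : ℝ} (hx : 0 < x) {z g : ℕ → ℂ} (hg : g 0 = 0)
    (hD : ∀ k : ℕ, ‖g (k + 1) - g k‖ ≤ D * (Real.log (k + 2) - Real.log (k + 1))) (N : ℕ) :
    ‖∑ j ∈ Finset.range N, z j * g j‖ ^ 2 ≤ D ^ 2 / (4 * x ^ 2) * tailEnergy x z N := by
  set d : ℕ → ℝ := fun k => ((k : ℝ) + 1) ^ (2 * x) - (k : ℝ) ^ (2 * x) with hd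
  have hdpos : ∀ k, 0 < d (k + 1) := fun k => by
    simp only [hd]
    exact sub_pos.mpr (Real.rpow_lt_rpow (by positivity) (by linarith) (by linarith))
  set R : ℕ → ℂ := fun k => ∑ j ∈ Finset.Ico k N, z j with hR
  -- Cauchy–Schwarz with weights `d (k + 1)`: Abel summation produces tails starting at `k + 1`, so
  -- the tail from `0` is not needed.
  have h1 : (∑ k ∈ Finset.range N, ‖g (k + 1) - g k‖ * ‖R (k + 1)‖) ^ 2 ≤
      (∑ k ∈ Finset.range N, ‖g (k + 1) - g k‖ ^ 2 / d (k + 1)) *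
        ∑ k ∈ Finset.range N, d (k + 1) * ‖R (k + 1)‖ ^ 2 := by
    refine Finset.sum_sq_le_sum_mul_sum_of_sq_le_mul _ (fun k _ => ?_) (fun k _ => ?_) fun k _ => ?_
    · exact div_nonneg (by positivity) (hdpos k).le
    · exact mul_nonneg (hdpos k).le (by positivity)
    · have := (hdpos k).ne'
      refine le_of_eq ?_
      field_simp
  have h2 : ∑ k ∈ Finset.range N, d (k + 1) * ‖R (k + 1)‖ ^ 2 ≤ tailEnergy x z N := by
    have e : tailEnergy x z N = ∑ k ∈ Finset.range (N + 1), d k * ‖R k‖ ^ 2 := by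
      rw [Finset.sum_range_succ]
      simp [tailEnergy, hd, hR]
    rw [e, Finset.sum_range_succ']
    have := mul_nonneg (weight_nonneg hx 0) (sq_nonneg ‖R 0‖)
    simp only [hd] at this ⊢
    linarith
  have h3 : ∑ k ∈ Finset.range N, ‖g (k + 1) - g k‖ ^ 2 / d (k + 1) ≤ D ^ 2 / (4 * x ^ 2) := by
    have hstep : ∀ k ∈ Finset.range N, ‖g (k + 1) - g k‖ ^ 2 / d (k + 1) ≤ D ^ 2 / (4 * x ^ 2) *
        (((k : ℝ) + 1) ^ (-(2 * x)) - (((k + 1 : ℕ) : ℝ) + 1) ^ (-(2 * x))) := by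
      intro k _
      rw [div_le_iff₀ (hdpos k)]
      -- Here `A = 2x log (k + 1)` and `B = 2x log (k + 2)`: `exp B - exp A` is `d (k + 1)`, the
      -- other factor telescopes to at most `1`, and `(B - A)²` accounts for the `4x²`.
      have h4 := sq_sub_le_exp_sub_mul_exp_sub (mul_le_mul_of_nonneg_right
        (Real.log_le_log (by positivity) (by linarith) : Real.log ((k : ℝ) + 1) ≤ Real.log (k + 2))
        (by positivity : 0 ≤ 2 * x))
      rw [← mul_neg (Real.log _) (2 * x), ← mul_neg (Real.log _) (2 * x), ← Real.rpow_def_of_pos (by positivity),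
        ← Real.rpow_def_of_pos (by positivity), ← Real.rpow_def_of_pos (by positivity),
        ← Real.rpow_def_of_pos (by positivity)] at h4
      have h5 := pow_le_pow_left₀ (norm_nonneg _) (hD k) 2
      refine h5.trans ?_
      simp only [hd]
      push_cast
      rw [show (k : ℝ) + 1 + 1 = k + 2 by ring]
      calc (D * (Real.log (k + 2) - Real.log (k + 1))) ^ 2 = D ^ 2 / (4 * x ^ 2) *
            (Real.log (k + 2) * (2 * x) - Real.log (k + 1) * (2 * x)) ^ 2 := by
            field_simp
            ring
        _ ≤ D ^ 2 / (4 * x ^ 2) * _ := mul_le_mul_of_nonneg_left h4 (by positivity)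
        _ = _ := by ring
    refine (Finset.sum_le_sum hstep).trans ?_
    rw [← Finset.mul_sum, Finset.sum_range_sub' (fun k : ℕ => ((k : ℝ) + 1) ^ (-(2 * x)))]
    refine mul_le_of_le_one_right (by positivity) ?_
    have : 0 ≤ ((N : ℝ) + 1) ^ (-(2 * x)) := by positivity
    simpa using this
  rw [sum_range_mul_eq_sum_sub_mul_tail z g hg]
  calc _ ≤ (∑ k ∈ Finset.range N, ‖g (k + 1) - g k‖ * ‖R (k + 1)‖) ^ 2 := by
        refine pow_le_pow_left₀ (norm_nonneg _) (norm_sum_le_of_le _ fun k _ => ?_) 2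
        rw [norm_mul]
    _ ≤ _ := h1
    _ ≤ _ := mul_le_mul h3 h2
        (Finset.sum_nonneg fun k _ => mul_nonneg (hdpos k).le (by positivity)) (by positivity)

/-! ### The harmonic majorant of a Dirichlet polynomial. -/

/-- A bound on all indices in the support of `a`. -/
noncomputable def polyBound (a : ℕ+ →₀ ℂ) : ℕ := a.support.sup fun n => (n : ℕ)

theorem sum_support_eq_sum_range {E : Type*} [AddCommMonoid E] (a : ℕ+ →₀ ℂ) {F : ℕ+ → E}
    (hF : ∀ n, a n = 0 → F n = 0) :
    ∑ n ∈ a.support, F n = ∑ j ∈ Finset.range (polyBound a), F j.succPNat := by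
  rw [← Finset.sum_image (f := F) fun i _ j _ h => Nat.succPNat_injective h]
  refine Finset.sum_subset (fun n hn => ?_) fun n _ hn => hF n (Finsupp.notMem_support_iff.mp hn)
  rw [Finset.mem_image]
  have h1 : (n : ℕ) ≤ polyBound a := Finset.le_sup (f := fun n : ℕ+ => (n : ℕ)) hn
  exact ⟨n.natPred, Finset.mem_range.mpr (by have := n.natPred_add_one; omega),
    n.succPNat_natPred⟩

/-- A harmonic majorant, on the right half-plane, of the squared modulus of the Dirichlet polynomial
with coefficients `a`. -/
noncomputable def majorant (a : ℕ+ →₀ ℂ) (w : ℂ) : ℝ :=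
  tailEnergy w.re (fun j => a j.succPNat * ((j.succPNat : ℕ) : ℂ) ^ (-w)) (polyBound a)

theorem dirichletPoly_eq_sum_range (w : ℂ) (a : ℕ+ →₀ ℂ) : dirichletPoly w a =
    ∑ j ∈ Finset.range (polyBound a), a j.succPNat * ((j.succPNat : ℕ) : ℂ) ^ (-w) := by
  rw [dirichletPoly_apply]
  exact sum_support_eq_sum_range a (F := fun n => a n * ((n : ℕ) : ℂ) ^ (-w)) fun n hn => by
    simp [hn]

theorem majorant_nonneg {w : ℂ} (hw : 0 < w.re) (a : ℕ+ →₀ ℂ) : 0 ≤ majorant a w :=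
  tailEnergy_nonneg hw _ _

theorem rpow_mul_norm_dirichletPoly_sq_le {w : ℂ} (hw : 0 < w.re) {a : ℕ+ →₀ ℂ} {M : ℕ}
    (ha : ∀ n : ℕ+, (n : ℕ) ≤ M → a n = 0) :
    ((M : ℝ) + 1) ^ (2 * w.re) * ‖dirichletPoly w a‖ ^ 2 ≤ majorant a w := by
  rw [dirichletPoly_eq_sum_range]
  refine rpow_mul_norm_sum_sq_le_tailEnergy hw fun j hj => ?_
  rw [ha j.succPNat (by rw [Nat.succPNat_coe]; omega), zero_mul]

theorem norm_dirichletPoly_sq_le_majorant {w : ℂ} (hw : 0 < w.re) (a : ℕ+ →₀ ℂ) :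
    ‖dirichletPoly w a‖ ^ 2 ≤ majorant a w := by
  have := rpow_mul_norm_dirichletPoly_sq_le hw (a := a) (M := 0) fun n hn =>
    absurd hn (by have := n.pos; omega)
  simpa using this

/-- Write `n^(-w) - n^(-w') = n^(-w) (1 - n^(-(w' - w)))` and sum by parts. As `Re w ≤ Re w'`, the
exponents of the second factor have nonpositive real part, where `exp` is 1-Lipschitz, so its
increments are at most `|w - w'|` times those of `log n`. -/
theorem norm_dirichletPoly_sub_sq_le_of_re_le {w w' : ℂ} (hw : 0 < w.re) (hww' : w.re ≤ w'.re)
    (a : ℕ+ →₀ ℂ) : ‖dirichletPoly w a - dirichletPoly w' a‖ ^ 2 ≤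
      ‖w - w'‖ ^ 2 / (4 * w.re ^ 2) * majorant a w := by
  have h := norm_sum_mul_sq_le_tailEnergy (D := ‖w - w'‖) hw
    (z := fun j => a j.succPNat * ((j.succPNat : ℕ) : ℂ) ^ (-w))
    (g := fun j => 1 - ((j.succPNat : ℕ) : ℂ) ^ (-(w' - w))) (by simp) (fun k => ?_) (polyBound a)
  · refine le_trans (le_of_eq ?_) h
    congr 2
    rw [dirichletPoly_eq_sum_range, dirichletPoly_eq_sum_range, ← Finset.sum_sub_distrib]
    refine Finset.sum_congr rfl fun j _ => ?_
    rw [mul_sub, mul_one, mul_assoc, ← Complex.cpow_add _ _ (Nat.cast_ne_zero.mpr (PNat.ne_zero _)),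
      ← neg_add, add_sub_cancel]
  · have hlog : ∀ n : ℕ+, (-((Real.log n : ℂ) * (w' - w))).re ≤ 0 := fun n => by
      rw [Complex.neg_re, Complex.re_ofReal_mul, Complex.sub_re]
      exact neg_nonpos.mpr (mul_nonneg (Real.log_natCast_nonneg _) (by linarith))
    rw [sub_sub_sub_cancel_left, natCast_cpow_neg_eq_exp, natCast_cpow_neg_eq_exp]
    refine (norm_exp_sub_exp_le (hlog _) (hlog _)).trans (le_of_eq ?_)
    rw [show ∀ p q r : ℂ, -(p * r) - -(q * r) = -r * (p - q) from fun _ _ _ => by ring, neg_sub,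
      norm_mul, ← Complex.ofReal_sub, Complex.norm_real, Real.norm_eq_abs, abs_sub_comm, abs_of_nonneg]
    · simp only [Nat.succPNat_coe, Nat.succ_eq_add_one]
      push_cast
      ring_nf
    · exact sub_nonneg.mpr (Real.log_le_log (by simp; positivity) (by simp))

theorem norm_dirichletPoly_sub_sq_le {w w' : ℂ} {K : ℝ} (hw : 0 < w.re) (hw' : 0 < w'.re)
    (hK : ‖w - w'‖ ≤ K * min w.re w'.re) (a : ℕ+ →₀ ℂ) :
    ‖dirichletPoly w a - dirichletPoly w' a‖ ^ 2 ≤ K ^ 2 * (majorant a w + majorant a w') := by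
  wlog hle : w.re ≤ w'.re generalizing w w'
  · rw [norm_sub_rev, add_comm]
    exact this hw' hw (by rwa [norm_sub_rev, min_comm]) (le_of_not_ge hle)
  rw [min_eq_left hle] at hK
  refine (norm_dirichletPoly_sub_sq_le_of_re_le hw hle a).trans ?_
  have h1 := majorant_nonneg hw a
  have h2 := majorant_nonneg hw' a
  have h3 : ‖w - w'‖ ^ 2 / (4 * w.re ^ 2) ≤ K ^ 2 := by
    rw [div_le_iff₀ (by positivity)]
    nlinarith [pow_le_pow_left₀ (norm_nonneg _) hK 2, sq_nonneg (K * w.re)]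
  calc _ ≤ K ^ 2 * majorant a w := mul_le_mul_of_nonneg_right h3 h1
    _ ≤ _ := mul_le_mul_of_nonneg_left (by linarith) (sq_nonneg K)

/-- The mean value of the majorant along a symbol of positive characteristic. -/
theorem hasMean_majorant {φ ψ : ℂ → ℂ} {c₀ : ℕ} (hc₀ : 1 ≤ c₀)
    (hφ : ∀ s ∈ halfPlane 0, φ s = c₀ * s + ψ s) (hψ : IsUniformDirichlet ψ)
    (hre : ∀ s ∈ halfPlane 0, 0 ≤ (ψ s).re) (a : ℕ+ →₀ ℂ) {σ : ℝ} (hσ : 0 < σ) :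
    HasMean (fun t => (majorant a (φ (σ + t * Complex.I)) : ℂ))
      ((‖HardyDirichlet.ofPoly 0 a‖ ^ 2 : ℝ) : ℂ) := by
  have hmem : ∀ t : ℝ, (σ + t * Complex.I : ℂ) ∈ halfPlane 0 := fun t => by
    simpa [halfPlane] using hσ
  have hpos : ∀ t : ℝ, 0 < (φ (σ + t * Complex.I)).re := fun t => by
    rw [hφ _ (hmem t), Complex.add_re, ← Complex.ofReal_natCast, Complex.re_ofReal_mul]
    have h1 : (1 : ℝ) ≤ c₀ := by exact_mod_cast hc₀
    have h2 : 0 < (c₀ : ℝ) * (σ + t * Complex.I : ℂ).re := mul_pos (by linarith) (hmem t)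
    linarith [hre _ (hmem t)]
  -- `exp (-μφ)` is `exp (-μ c₀ s)` times the uniform limit `exp (-μψ)`; as `c₀ ≥ 1`, the first
  -- factor shifts all frequencies away from zero.
  have hexp : ∀ {μ : ℝ}, 0 < μ →
      HasMean (fun t => Complex.exp (-(μ * φ (σ + t * Complex.I)))) 0 := by
    intro μ hμ
    have hE : IsUniformDirichlet fun s => Complex.exp (-μ * ψ s) :=
      ((IsUniformDirichlet.const (-μ)).mul hψ).exp
    convert hE.hasMean_exp_mul (show 0 < μ * c₀ by positivity) hσ using 2 with t
    rw [← Complex.exp_add, hφ _ (hmem t)]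
    congr 1
    push_cast
    ring
  have hterm : ∀ i j : ℕ, HasMean (fun t : ℝ =>
      (((((min i j : ℕ) : ℝ) + 1) ^ (2 * (φ (σ + t * Complex.I)).re) : ℝ) : ℂ) *
        ((a i.succPNat * ((i.succPNat : ℕ) : ℂ) ^ (-φ (σ + t * Complex.I))) * (starRingEnd ℂ)
          (a j.succPNat * ((j.succPNat : ℕ) : ℂ) ^ (-φ (σ + t * Complex.I)))))
      (if j = i then ((‖a i.succPNat‖ ^ 2 : ℝ) : ℂ) else 0) := by
    intro i j
    have hl : ∀ {i j : ℕ}, i < j → 0 < Real.log j.succPNat - Real.log i.succPNat := fun hij =>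
      sub_pos.mpr (Real.log_lt_log (by simp; positivity) (by simpa using hij))
    have hw : ∀ (k : ℕ) (w : ℂ), ((((k : ℝ) + 1) ^ (2 * w.re) : ℝ) : ℂ) =
        Complex.exp (Real.log k.succPNat * (w + (starRingEnd ℂ) w)) := fun k w => by
      rw [Real.rpow_def_of_pos (by positivity), Complex.ofReal_exp, Complex.add_conj]
      simp
    simp only [hw, natCast_cpow_neg_eq_exp, map_mul, ← Complex.exp_conj, map_neg,
      Complex.conj_ofReal]
    -- Off the diagonal the weight cancels the smaller index: the term is a multiple of `exp (-μφ)`,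
    -- conjugated if `i < j`, with `μ = |log (j+1) - log (i+1)|`. On the diagonal it is constant.
    rcases lt_trichotomy i j with hij | rfl | hij
    · rw [if_neg hij.ne', min_eq_left hij.le]
      have := ((hexp (hl hij)).conj).const_mul
        (a i.succPNat * (starRingEnd ℂ) (a j.succPNat))
      simp only [map_zero, mul_zero, ← Complex.exp_conj, map_mul, map_neg,
        Complex.conj_ofReal] at this
      convert this using 2 with t
      rw [show ∀ p q r u v : ℂ, p * (q * r * (u * v)) = q * u * (p * r * v) from
        fun _ _ _ _ _ => by ring, ← Complex.exp_add, ← Complex.exp_add]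
      congr 2
      push_cast
      ring
    · rw [if_pos rfl, min_self]
      convert HasMean.const _ using 2 with t
      rw [show ∀ p q r u v : ℂ, p * (q * r * (u * v)) = q * u * (p * r * v) from
        fun _ _ _ _ _ => by ring, ← Complex.exp_add, ← Complex.exp_add, Complex.mul_conj']
      rw [show ∀ l w w' : ℂ, l * (w + w') + -(l * w) + -(l * w') = 0 from fun _ _ _ => by ring]
      simp
    · rw [if_neg hij.ne, min_eq_right hij.le]
      have := (hexp (hl hij)).const_mul (a i.succPNat * (starRingEnd ℂ) (a j.succPNat))
      simp only [mul_zero] at this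
      convert this using 2 with t
      rw [show ∀ p q r u v : ℂ, p * (q * r * (u * v)) = q * u * (p * r * v) from
        fun _ _ _ _ _ => by ring, ← Complex.exp_add, ← Complex.exp_add]
      congr 2
      push_cast
      ring
  have h := HasMean.sum (Finset.range (polyBound a)) fun i _ =>
    HasMean.sum (Finset.range (polyBound a)) fun j _ => hterm i j
  convert h using 1
  · funext t
    rw [majorant, tailEnergy_eq_sum_sum (hpos t)]
  · rw [HardyDirichlet.norm_ofPoly_sq, sum_support_eq_sum_range a fun n hn => by simp [hn]]
    push_cast
    refine Finset.sum_congr rfl fun i hi => ?_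
    simp [Finset.sum_ite_eq', Finset.mem_range.mp hi]

/-! ### Symbols of positive characteristic and bounds for their operators. -/

theorem IsUniformDirichlet.congr {F G : ℂ → ℂ} (hF : IsUniformDirichlet F)
    (h : ∀ s ∈ halfPlane 0, G s = F s) : IsUniformDirichlet G :=
  fun ε hε η hη => (hF ε hε η hη).imp fun _ ha s hs => by
    rw [h s (hε.trans hs)]
    exact ha s hs

/-- A symbol of positive characteristic `c₀`, without the requirement that it be analytic. -/
structure IsPositiveSymbol (φ : ℂ → ℂ) (c₀ : ℕ) (ψ : ℂ → ℂ) : Prop where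
  one_le : 1 ≤ c₀
  eq_add : ∀ s ∈ halfPlane 0, φ s = c₀ * s + ψ s
  uniform : IsUniformDirichlet ψ
  re_nonneg : ∀ s ∈ halfPlane 0, 0 ≤ (ψ s).re

namespace IsPositiveSymbol

variable {φ ψ : ℂ → ℂ} {c₀ : ℕ}

theorem re_le (h : IsPositiveSymbol φ c₀ ψ) {s : ℂ} (hs : s ∈ halfPlane 0) : s.re ≤ (φ s).re := by
  rw [h.eq_add s hs, Complex.add_re, ← Complex.ofReal_natCast, Complex.re_ofReal_mul]
  have h1 : (1 : ℝ) ≤ c₀ := by exact_mod_cast h.one_le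
  have h2 : 0 < s.re := hs
  nlinarith [h.re_nonneg s hs]

theorem re_pos (h : IsPositiveSymbol φ c₀ ψ) {s : ℂ} (hs : s ∈ halfPlane 0) : 0 < (φ s).re :=
  lt_of_lt_of_le hs (h.re_le hs)

theorem mapsTo (h : IsPositiveSymbol φ c₀ ψ) :
    Set.MapsTo φ (halfPlane (1 / 2)) (halfPlane (1 / 2)) := fun s hs =>
  lt_of_lt_of_le hs (h.re_le (lt_trans (by norm_num : (0 : ℝ) < 1 / 2) hs))

/-- On the right half-plane `n^(-φ(s)) = (n^c₀)^(-s) exp (-log n ψ(s))`, and `n^c₀` is a positive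
integer because `c₀` is. -/
theorem isUniformDirichlet_comp (h : IsPositiveSymbol φ c₀ ψ) (a : ℕ+ →₀ ℂ) :
    IsUniformDirichlet fun s => dirichletPoly (φ s) a := by
  have h1 : ∀ n : ℕ+, IsUniformDirichlet fun s =>
      a n * ((((n ^ c₀ : ℕ+) : ℕ) : ℂ) ^ (-s) * Complex.exp (-(Real.log n : ℂ) * ψ s)) := fun n =>
    (IsUniformDirichlet.const _).mul ((IsUniformDirichlet.cpow _).mul
      ((IsUniformDirichlet.const _).mul h.uniform).exp)
  refine (IsUniformDirichlet.sum a.support fun n _ => h1 n).congr fun s hs => ?_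
  rw [dirichletPoly_apply]
  refine Finset.sum_congr rfl fun n _ => ?_
  rw [natCast_cpow_neg_eq_exp, natCast_cpow_neg_eq_exp, h.eq_add s hs, ← Complex.exp_add]
  congr 2
  rw [PNat.pow_coe, Nat.cast_pow, Real.log_pow]
  push_cast
  ring

end IsPositiveSymbol

namespace HardyDirichlet

theorem eval_add (f g : HardyDirichlet) {s : ℂ} (hs : s ∈ halfPlane (1 / 2)) :
    (f + g).eval s = f.eval s + g.eval s := by
  obtain ⟨e, he⟩ := exists_evalCLM hs
  simp only [← he, map_add]

theorem eval_smul (c : ℂ) (f : HardyDirichlet) {s : ℂ} (hs : s ∈ halfPlane (1 / 2)) :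
    (c • f).eval s = c * f.eval s := by
  obtain ⟨e, he⟩ := exists_evalCLM hs
  simp only [← he, map_smul, smul_eq_mul]

theorem eval_sub (f g : HardyDirichlet) {s : ℂ} (hs : s ∈ halfPlane (1 / 2)) :
    (f - g).eval s = f.eval s - g.eval s := by
  obtain ⟨e, he⟩ := exists_evalCLM hs
  simp only [← he, map_sub]

theorem eval_ofPoly_zero (a : ℕ+ →₀ ℂ) (s : ℂ) : (ofPoly 0 a).eval s = dirichletPoly s a := by
  simp [eval_ofPoly]

/-- A function dominated by majorants along symbols belongs to the Hardy space. -/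
theorem exists_eval_eq_of_le_majorant {φ ψ φ' ψ' : ℂ → ℂ} {c₀ c₀' : ℕ}
    (h : IsPositiveSymbol φ c₀ ψ) (h' : IsPositiveSymbol φ' c₀' ψ') {F : ℂ → ℂ}
    (hF : IsUniformDirichlet F) {a : ℕ+ →₀ ℂ} {K : ℝ}
    (hK : ∀ s ∈ halfPlane 0, ‖F s‖ ^ 2 ≤ K * (majorant a (φ s) + majorant a (φ' s))) :
    ∃ b : HardyDirichlet, ‖b‖ ^ 2 ≤ 2 * K * ‖ofPoly 0 a‖ ^ 2 ∧
      ∀ s ∈ halfPlane (1 / 2), b.eval s = F s := by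
  refine exists_eval_eq hF fun σ hσ => ⟨_, _,
    ((hasMean_majorant h.one_le h.eq_add h.uniform h.re_nonneg a hσ).add
      (hasMean_majorant h'.one_le h'.eq_add h'.uniform h'.re_nonneg a hσ)).const_mul (K : ℂ),
      ?_, fun t => ?_⟩
  · rw [Complex.re_ofReal_mul, Complex.add_re, Complex.ofReal_re]
    linarith
  · rw [Complex.re_ofReal_mul, Complex.add_re, Complex.ofReal_re, Complex.ofReal_re]
    exact hK _ (by simpa [halfPlane] using hσ)

end HardyDirichlet

open HardyDirichlet

/-- A symbol of positive characteristic induces a bounded composition operator. -/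
theorem IsPositiveSymbol.exists_isCompositionOperator {φ ψ : ℂ → ℂ} {c₀ : ℕ}
    (h : IsPositiveSymbol φ c₀ ψ) :
    ∃ T : HardyDirichlet →L[ℂ] HardyDirichlet, IsCompositionOperator φ T := by
  -- The two-symbol criterion is applied with both symbols equal to `φ`; the resulting factor 2 is
  -- harmless.
  have hex : ∀ a : ℕ+ →₀ ℂ, ∃ b : HardyDirichlet, ‖b‖ ^ 2 ≤ 2 * 1 * ‖ofPoly 0 a‖ ^ 2 ∧
      ∀ s ∈ halfPlane (1 / 2), b.eval s = dirichletPoly (φ s) a := fun a =>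
    exists_eval_eq_of_le_majorant h h (h.isUniformDirichlet_comp a) fun s hs => by
      linarith [norm_dirichletPoly_sq_le_majorant (h.re_pos hs) a, majorant_nonneg (h.re_pos hs) a]
  choose b hb hbe using hex
  let T₀ : (ℕ+ →₀ ℂ) →ₗ[ℂ] HardyDirichlet :=
    { toFun := b
      map_add' := fun x y => eq_of_eval_eq fun s hs => by
        rw [eval_add _ _ hs, hbe _ s hs, hbe _ s hs, hbe _ s hs, map_add]
      map_smul' := fun c x => eq_of_eval_eq fun s hs => by
        rw [RingHom.id_apply, eval_smul _ _ hs, hbe _ s hs, hbe _ s hs, map_smul, smul_eq_mul] }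
  have hbound : ∀ a, ‖T₀ a‖ ≤ 2 * ‖ofPoly 0 a‖ := fun a => by
    refine (sq_le_sq₀ (norm_nonneg _) (by positivity)).mp ((hb a).trans ?_)
    nlinarith [sq_nonneg ‖ofPoly 0 a‖]
  refine ⟨T₀.extendOfNorm (ofPoly 0), fun f s hs => ?_⟩
  obtain ⟨e, he⟩ := exists_evalCLM hs
  obtain ⟨e', he'⟩ := exists_evalCLM (h.mapsTo hs)
  rw [← he, ← he']
  refine denseRange_ofPoly_zero.induction_on f (isClosed_eq (by fun_prop) (by fun_prop)) fun a => ?_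
  rw [LinearMap.extendOfNorm_eq denseRange_ofPoly_zero ⟨2, hbound⟩, he, he', eval_ofPoly_zero]
  exact hbe a s hs

/-- Turns a pointwise estimate by majorants into a norm estimate: the function built from the
criterion has the same values as the image under `T - T'`, hence equals it. -/
theorem norm_sub_ofPoly_sq_le {φ ψ φ' ψ' : ℂ → ℂ} {c₀ c₀' : ℕ}
    {T T' : HardyDirichlet →L[ℂ] HardyDirichlet}
    (h : IsPositiveSymbol φ c₀ ψ) (h' : IsPositiveSymbol φ' c₀' ψ')
    (hT : IsCompositionOperator φ T) (hT' : IsCompositionOperator φ' T') {a : ℕ+ →₀ ℂ} {K : ℝ}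
    (hK : ∀ s ∈ halfPlane 0, ‖dirichletPoly (φ s) a - dirichletPoly (φ' s) a‖ ^ 2 ≤
      K * (majorant a (φ s) + majorant a (φ' s))) :
    ‖(T - T') (ofPoly 0 a)‖ ^ 2 ≤ 2 * K * ‖ofPoly 0 a‖ ^ 2 := by
  have hF : IsUniformDirichlet fun s => dirichletPoly (φ s) a - dirichletPoly (φ' s) a := by
    refine ((h.isUniformDirichlet_comp a).add
      ((IsUniformDirichlet.const (-1)).mul (h'.isUniformDirichlet_comp a))).congr fun s _ => ?_
    ring
  obtain ⟨b, hb, hbe⟩ := exists_eval_eq_of_le_majorant h h' hF hK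
  convert hb using 3
  refine eq_of_eval_eq fun s hs => ?_
  rw [hbe s hs, sub_apply, eval_sub _ _ hs, hT _ s hs, hT' _ s hs,
    eval_ofPoly_zero, eval_ofPoly_zero]

theorem norm_sub_le_of_norm_sub_le {φ ψ φ' ψ' : ℂ → ℂ} {c₀ c₀' : ℕ}
    {T T' : HardyDirichlet →L[ℂ] HardyDirichlet}
    (h : IsPositiveSymbol φ c₀ ψ) (h' : IsPositiveSymbol φ' c₀' ψ')
    (hT : IsCompositionOperator φ T) (hT' : IsCompositionOperator φ' T') {K : ℝ} (hK0 : 0 ≤ K)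
    (hK : ∀ s ∈ halfPlane 0, ‖φ s - φ' s‖ ≤ K * min (φ s).re (φ' s).re) :
    ‖T - T'‖ ≤ 2 * K := by
  refine ContinuousLinearMap.opNorm_le_bound _ (by positivity) fun f => ?_
  refine denseRange_ofPoly_zero.induction_on f (isClosed_le (by fun_prop) (by fun_prop)) fun a => ?_
  refine (sq_le_sq₀ (norm_nonneg _) (by positivity)).mp ?_
  refine (norm_sub_ofPoly_sq_le h h' hT hT' (K := K ^ 2) fun s hs =>
    norm_dirichletPoly_sub_sq_le (h.re_pos hs) (h'.re_pos hs) (hK s hs) a).trans ?_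
  nlinarith [sq_nonneg (K * ‖ofPoly 0 a‖)]

/-! ### Truncation and compactness of differences. -/

namespace HardyDirichlet

/-- The projection onto the Dirichlet polynomials with frequencies in `S`. -/
noncomputable def truncate (S : Finset ℕ+) : HardyDirichlet →L[ℂ] HardyDirichlet :=
  ∑ n ∈ S, (lp.evalCLM ℂ (fun _ : ℕ+ => ℂ) 2 n).smulRight (lp.single 2 n (1 : ℂ))

theorem isCompactOperator_smulRight (ℓ : HardyDirichlet →L[ℂ] ℂ) (v : HardyDirichlet) :
    IsCompactOperator (ℓ.smulRight v) :=
  (isCompactOperator_of_locallyCompactSpace_dom ℓ).continuous_comp (g := fun z : ℂ => z • v)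
    (by fun_prop)

theorem isCompactOperator_truncate (S : Finset ℕ+) : IsCompactOperator (truncate S) := by
  classical
  unfold truncate
  induction S using Finset.induction_on with
  | empty => exact isCompactOperator_zero
  | insert n S hn ih =>
    rw [Finset.sum_insert hn]
    exact IsCompactOperator.add (isCompactOperator_smulRight _ _) ih

theorem truncate_apply (S : Finset ℕ+) (f : HardyDirichlet) (m : ℕ+) :
    truncate S f m = if m ∈ S then f m else 0 := by
  rw [truncate, sum_apply, lp.coeFn_sum, Finset.sum_apply]
  simp [lp.single_apply, Pi.single_apply, lp.evalCLM]

theorem sub_truncate_ofPoly (S : Finset ℕ+) (a : ℕ+ →₀ ℂ) :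
    ofPoly 0 a - truncate S (ofPoly 0 a) = ofPoly 0 (a.filter (· ∉ S)) := by
  ext m
  rw [lp.coeFn_sub, Pi.sub_apply, truncate_apply, ofPoly_zero_apply, ofPoly_zero_apply,
    Finsupp.filter_apply]
  split_ifs <;> simp

theorem norm_ofPoly_filter_le (p : ℕ+ → Prop) [DecidablePred p] (a : ℕ+ →₀ ℂ) :
    ‖ofPoly 0 (a.filter p)‖ ≤ ‖ofPoly 0 a‖ := by
  refine lp.norm_mono (by norm_num) fun n => ?_
  rw [ofPoly_zero_apply, ofPoly_zero_apply, Finsupp.filter_apply]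
  split_ifs <;> simp

end HardyDirichlet

theorem isCompactOperator_sub_of_isLittleO {φ ψ φ' ψ' : ℂ → ℂ} {c₀ c₀' : ℕ}
    {T T' : HardyDirichlet →L[ℂ] HardyDirichlet}
    (h : IsPositiveSymbol φ c₀ ψ) (h' : IsPositiveSymbol φ' c₀' ψ')
    (hT : IsCompositionOperator φ T) (hT' : IsCompositionOperator φ' T')
    (ho : (fun s => φ s - φ' s) =o[minReToZero φ φ'] fun s => min (φ s).re (φ' s).re) :
    IsCompactOperator (T - T') := by
  have hcl := isClosed_setOfPred_isCompactOperator (σ₁₂ := RingHom.id ℂ)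
    (M₁ := HardyDirichlet) (M₂ := HardyDirichlet)
  suffices hsuff : T - T' ∈ closure
      {f : HardyDirichlet →L[ℂ] HardyDirichlet | IsCompactOperator f} by
    rwa [hcl.closure_eq] at hsuff
  refine Metric.mem_closure_iff.mpr fun ε hε => ?_
  obtain ⟨δ, hδ, hsmall⟩ : ∃ δ > 0, ∀ s ∈ halfPlane 0, min (φ s).re (φ' s).re < δ →
      ‖φ s - φ' s‖ ≤ ε / 4 * min (φ s).re (φ' s).re := by
    have h1 := (isLittleO_iff.mp ho) (show 0 < ε / 4 by positivity)
    rw [minReToZero, inf_comm, eventually_inf_principal, eventually_comap] at h1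
    obtain ⟨δ, hδ, h2⟩ := Metric.eventually_nhds_iff.mp h1
    refine ⟨δ, hδ, fun s hs hlt => ?_⟩
    have h3 : 0 < min (φ s).re (φ' s).re := lt_min (h.re_pos hs) (h'.re_pos hs)
    have h4 := h2 (y := min (φ s).re (φ' s).re)
      (by rwa [Real.dist_eq, sub_zero, abs_of_pos h3]) s rfl hs
    rwa [Real.norm_of_nonneg h3.le] at h4
  -- The factor 2 pays for `|u - v|² ≤ 2(|u|² + |v|²)` in the region where both real parts are at
  -- least `δ`.
  obtain ⟨N, hN⟩ : ∃ N : ℕ, 2 * ((N : ℝ) + 1) ^ (-(2 * δ)) ≤ (ε / 4) ^ 2 := by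
    have h1 : Tendsto (fun N : ℕ => 2 * ((N : ℝ) + 1) ^ (-(2 * δ))) atTop (𝓝 (2 * 0)) :=
      ((tendsto_rpow_neg_atTop (show 0 < 2 * δ by positivity)).comp
        (tendsto_atTop_add_const_right _ _ tendsto_natCast_atTop_atTop)).const_mul 2
    rw [mul_zero] at h1
    exact (h1.eventually_le_const (show 0 < (ε / 4) ^ 2 by positivity)).exists
  set S : Finset ℕ+ := (Finset.range N).image Nat.succPNat with hS
  have hSmem : ∀ n : ℕ+, (n : ℕ) ≤ N → n ∈ S := fun n hn => Finset.mem_image.mpr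
    ⟨n.natPred, Finset.mem_range.mpr (by have := n.natPred_add_one; omega), n.succPNat_natPred⟩
  -- The approximant is compact since `truncate S` is; the error acts only on the frequencies above
  -- `N`.
  refine ⟨(T - T').comp (truncate S), (isCompactOperator_truncate S).clm_comp (T - T'), ?_⟩
  rw [dist_eq_norm]
  refine lt_of_le_of_lt (ContinuousLinearMap.opNorm_le_bound _
    (show 0 ≤ ε / 2 by positivity) fun f => ?_) (half_lt_self hε)
  refine denseRange_ofPoly_zero.induction_on f (isClosed_le (by fun_prop) (by fun_prop)) fun a => ?_
  rw [sub_apply, ContinuousLinearMap.comp_apply, ← map_sub,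
    sub_truncate_ofPoly]
  set b := a.filter (· ∉ S) with hb
  have hb0 : ∀ n : ℕ+, (n : ℕ) ≤ N → b n = 0 := fun n hn => by
    rw [hb, Finsupp.filter_apply, if_neg (not_not.mpr (hSmem n hn))]
  refine le_trans ?_ (mul_le_mul_of_nonneg_left (norm_ofPoly_filter_le (· ∉ S) a)
    (show 0 ≤ ε / 2 by positivity))
  refine (sq_le_sq₀ (norm_nonneg _) (by positivity)).mp ?_
  refine (norm_sub_ofPoly_sq_le h h' hT hT' (K := (ε / 4) ^ 2) fun s hs => ?_).trans ?_
  · have hw := h.re_pos hs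
    have hw' := h'.re_pos hs
    -- Close to the boundary the little-o hypothesis controls the difference; farther away each of
    -- the two terms is small by itself, its frequencies all exceeding `N`.
    rcases lt_or_ge (min (φ s).re (φ' s).re) δ with hlt | hge
    · exact norm_dirichletPoly_sub_sq_le hw hw' (hsmall s hs hlt) b
    · have key : ∀ w : ℂ, 0 < w.re → δ ≤ w.re →
          ‖dirichletPoly w b‖ ^ 2 ≤ ((N : ℝ) + 1) ^ (-(2 * δ)) * majorant b w := by
        intro w hw hδw
        rw [Real.rpow_neg (by positivity), inv_mul_eq_div, le_div_iff₀' (by positivity)]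
        refine le_trans ?_ (rpow_mul_norm_dirichletPoly_sq_le hw hb0)
        gcongr
        linarith [(Nat.cast_nonneg N : (0 : ℝ) ≤ N)]
      have h1 := key _ hw (hge.trans (min_le_left _ _))
      have h2 := key _ hw' (hge.trans (min_le_right _ _))
      have h3 := pow_le_pow_left₀ (norm_nonneg _)
        (norm_sub_le (dirichletPoly (φ s) b) (dirichletPoly (φ' s) b)) 2
      have h4 := sq_nonneg (‖dirichletPoly (φ s) b‖ - ‖dirichletPoly (φ' s) b‖)
      have h5 := mul_le_mul_of_nonneg_right hN
        (add_nonneg (majorant_nonneg hw b) (majorant_nonneg hw' b))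
      nlinarith
  · nlinarith [sq_nonneg (ε * ‖ofPoly 0 b‖)]

/-! ### Gordon–Hedenmalm maps and the conclusion. -/

theorem isOpen_halfPlane (θ : ℝ) : IsOpen (halfPlane θ) :=
  isOpen_lt continuous_const Complex.continuous_re

namespace IsGordonHedenmalm

variable {φ ψ : ℂ → ℂ} {c₀ : ℕ}

theorem isUniformDirichlet (h : IsGordonHedenmalm φ c₀ ψ) : IsUniformDirichlet ψ := by
  obtain ⟨c, hc⟩ := h.series
  intro ε hε η hη
  obtain ⟨N, hN⟩ := ((Metric.tendstoUniformlyOn_iff.mp (hc ε hε)) η hη).exists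
  refine ⟨∑ j ∈ Finset.range N, Finsupp.single j.succPNat (c (j + 1)), fun s hs => ?_⟩
  have h1 := (hN s hs).le
  have h2 : ∀ f : ℕ → ℂ, ∑ n ∈ Finset.Icc 1 N, f n = ∑ j ∈ Finset.range N, f (j + 1) := fun f => by
    rw [Finset.range_eq_Ico, Finset.sum_Ico_add' f 0 N 1, zero_add, Finset.Ico_add_one_right_eq_Icc]
  rw [dist_eq_norm, h2] at h1
  simpa [map_sum, dirichletPoly_single] using h1

theorem isPositiveSymbol (h : IsGordonHedenmalm φ c₀ ψ) (hc₀ : 1 ≤ c₀) :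
    IsPositiveSymbol φ c₀ ψ where
  one_le := hc₀
  eq_add := h.eq_add
  uniform := h.isUniformDirichlet
  re_nonneg s hs := by
    rcases h.char_pos hc₀ with ⟨c₁, hc₁, hψ⟩ | hψ
    · rwa [hψ s hs]
    · exact le_of_lt (hψ hs)

theorem differentiableOn (h : IsGordonHedenmalm φ c₀ ψ) :
    DifferentiableOn ℂ φ (halfPlane (1 / 2)) := by
  obtain ⟨c, hc⟩ := h.series
  have h1 : DifferentiableOn ℂ ψ (halfPlane (1 / 2)) := by
    refine (hc _ (by norm_num)).tendstoLocallyUniformlyOn.differentiableOn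
      (Eventually.of_forall fun N => ?_) (isOpen_halfPlane _)
    refine DifferentiableOn.fun_sum fun n hn => ?_
    have hn0 : (n : ℂ) ≠ 0 := Nat.cast_ne_zero.mpr (by have := Finset.mem_Icc.mp hn; omega)
    exact (differentiableOn_const _).mul (differentiableOn_id.neg.const_cpow (Or.inl hn0))
  refine (((differentiableOn_const (c₀ : ℂ)).mul differentiableOn_id).add h1).congr fun s hs => ?_
  exact h.eq_add s (lt_trans (by norm_num : (0 : ℝ) < 1 / 2) hs)

end IsGordonHedenmalm

/-- Symbols on the segment between two symbols of the same positive characteristic. -/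
theorem IsPositiveSymbol.segment {φ₀ φ₁ ψ₀ ψ₁ : ℂ → ℂ} {c₀ : ℕ} (h₀ : IsPositiveSymbol φ₀ c₀ ψ₀)
    (h₁ : IsPositiveSymbol φ₁ c₀ ψ₁) {r : ℝ} (hr : r ∈ Set.Icc (0 : ℝ) 1) :
    IsPositiveSymbol (fun s => (1 - r : ℝ) * φ₀ s + r * φ₁ s) c₀
      (fun s => (1 - r : ℝ) * ψ₀ s + r * ψ₁ s) where
  one_le := h₀.one_le
  eq_add s hs := by
    rw [h₀.eq_add s hs, h₁.eq_add s hs]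
    push_cast
    ring
  uniform := ((IsUniformDirichlet.const _).mul h₀.uniform).add
    ((IsUniformDirichlet.const _).mul h₁.uniform)
  re_nonneg s hs := by
    rw [Complex.add_re, Complex.re_ofReal_mul, Complex.re_ofReal_mul]
    exact add_nonneg (mul_nonneg (by linarith [hr.2]) (h₀.re_nonneg s hs))
      (mul_nonneg hr.1 (h₁.re_nonneg s hs))

theorem mainTheorem8 (φ₀ φ₁ ψ₀ ψ₁ : ℂ → ℂ) (c₀ : ℕ) (hc₀ : 1 ≤ c₀)
    (h₀ : IsGordonHedenmalm φ₀ c₀ ψ₀) (h₁ : IsGordonHedenmalm φ₁ c₀ ψ₁)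
    (C : ℝ) (hC : 0 < C)
    (hdiff : ∀ s ∈ halfPlane 0, ‖φ₀ s - φ₁ s‖ ≤ C * min (φ₀ s).re (φ₁ s).re)
    (hψ₀ : ∀ s ∈ halfPlane 0, ‖ψ₀ s‖ ≤ C) (hψ₁ : ∀ s ∈ halfPlane 0, ‖ψ₁ s‖ ≤ C)
    (hderiv : ∀ s ∈ halfPlane 0, ‖deriv φ₀ s - deriv φ₁ s‖ ≤ C) :
    ∃ T₀ T₁ : HardyDirichlet →L[ℂ] HardyDirichlet,
      IsCompositionOperator φ₀ T₀ ∧ IsCompositionOperator φ₁ T₁ ∧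
      T₁ ∈ connectedComponentIn compositionOperators T₀ ∧
      ((fun s => φ₀ s - φ₁ s) =o[minReToZero φ₀ φ₁] (fun s => min (φ₀ s).re (φ₁ s).re) →
        Tendsto (fun s => deriv φ₀ s - deriv φ₁ s) (minReToZero φ₀ φ₁) (𝓝 0) →
        IsCompactOperator (T₀ - T₁)) := by

  have p₀ := h₀.isPositiveSymbol hc₀
  have p₁ := h₁.isPositiveSymbol hc₀
  set Φ : ℝ → ℂ → ℂ := fun r s => (1 - r : ℝ) * φ₀ s + r * φ₁ s with hΦ
  have hsym : ∀ r ∈ Set.Icc (0 : ℝ) 1, IsPositiveSymbol (Φ r) c₀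
      (fun s => (1 - r : ℝ) * ψ₀ s + r * ψ₁ s) := fun r hr => p₀.segment p₁ hr
  -- Outside `[0, 1]` the operators `T r` are arbitrary and play no role.
  choose! T hT using fun r (hr : r ∈ Set.Icc (0 : ℝ) 1) => (hsym r hr).exists_isCompositionOperator
  have hmin : ∀ r ∈ Set.Icc (0 : ℝ) 1, ∀ s, min (φ₀ s).re (φ₁ s).re ≤ (Φ r s).re := by
    intro r hr s
    simp only [hΦ, Complex.add_re, Complex.re_ofReal_mul]
    nlinarith [mul_le_mul_of_nonneg_left (min_le_left (φ₀ s).re (φ₁ s).re)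
      (show 0 ≤ 1 - r by linarith [hr.2]),
      mul_le_mul_of_nonneg_left (min_le_right (φ₀ s).re (φ₁ s).re) hr.1]
  have hlip : ∀ r ∈ Set.Icc (0 : ℝ) 1, ∀ r' ∈ Set.Icc (0 : ℝ) 1,
      ‖T r - T r'‖ ≤ 2 * (|r - r'| * C) := by
    intro r hr r' hr'
    refine norm_sub_le_of_norm_sub_le (hsym r hr) (hsym r' hr') (hT r hr) (hT r' hr')
      (by positivity) fun s hs => ?_
    -- The terms `c₀ s` cancel in `φ₀ - φ₁`, and real parts along the segment stay above the minimum
    -- at its ends, so the hypothesis on `φ₀ - φ₁` holds for `Φ r` and `Φ r'` with constant `|r -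
    -- r'| C`.
    have h1 : Φ r s - Φ r' s = -((r - r' : ℝ) : ℂ) * (φ₀ s - φ₁ s) := by
      simp only [hΦ]
      push_cast
      ring
    rw [h1, norm_mul, norm_neg, Complex.norm_real, Real.norm_eq_abs, mul_assoc]
    refine mul_le_mul_of_nonneg_left ((hdiff s hs).trans ?_) (abs_nonneg _)
    exact mul_le_mul_of_nonneg_left (le_min (hmin r hr s) (hmin r' hr' s)) hC.le
  have hcont : ContinuousOn T (Set.Icc 0 1) := by
    refine (LipschitzOnWith.of_dist_le_mul (K := (2 * C).toNNReal)
      fun r hr r' hr' => ?_).continuousOn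
    rw [dist_eq_norm, Real.dist_eq]
    refine (hlip r hr r' hr').trans (le_of_eq ?_)
    rw [Real.coe_toNNReal _ (by positivity)]
    ring
  have hmem0 : (0 : ℝ) ∈ Set.Icc (0 : ℝ) 1 := by simp
  have hmem1 : (1 : ℝ) ∈ Set.Icc (0 : ℝ) 1 := by simp
  have hT0 : IsCompositionOperator φ₀ (T 0) := by simpa [hΦ] using hT 0 hmem0
  have hT1 : IsCompositionOperator φ₁ (T 1) := by simpa [hΦ] using hT 1 hmem1
  refine ⟨T 0, T 1, hT0, hT1, ?_, fun ho _ => isCompactOperator_sub_of_isLittleO p₀ p₁ hT0 hT1 ho⟩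
  -- The image of `[0, 1]` under `T` is a connected set of composition operators joining the two.
  refine (isPreconnected_Icc.image T hcont).subset_connectedComponentIn
    (Set.mem_image_of_mem T hmem0) ?_ (Set.mem_image_of_mem T hmem1)
  rintro _ ⟨r, hr, rfl⟩
  exact ⟨Φ r, ((differentiableOn_const _).mul h₀.differentiableOn).add
    ((differentiableOn_const _).mul h₁.differentiableOn), (hsym r hr).mapsTo, hT r hr⟩
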